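/- **Theorem.** Let $a,b>0$ and $p>6$. Regard $\mathbb Z^3$ as the lattice graph with $x\sim y$ iff $\sum_i|x_i-y_i|=1$, put $\nabla u\nabla v(x)=\frac12\sum_{y\sim x}(u(y)-u(x))(v(y)-v(x))$, $|\nabla u|^2=\nabla u\nabla u$, $\Delta u(x)=\sum_{y\sim x}(u(y)-u(x))$, and write $\int_A f\,d\mu=\sum_{x\in A}f(x)$. Let $h:\mathbb Z^3\to\mathbb R$ satisfy * $(h_1)$ $h\ge 0$, and $\Omega=\{x: h(x)=0\}$ is connected, bounded and has at least two points; * $(h_2)$ there is $M>0$ such that $\{x: h(x)<M\}$ is finite. For $\lambda>0$ consider $$-\Big(a+b\int_{\mathbb Z^3}|\nabla u|^2d\mu\Big)\Delta u+(\lambda h+1)u=|u|^{p-2}u\log u^2\quad\text{in }\mathbb Z^3 \tag{1}$$ and the limiting Dirichlet problem $$-\Big(a+b\int_{\Omega\cup\partial\Omega}|\nabla u|^2d\mu\Big)\Delta u+u=|u|^{p-2}u\log u^2\ \text{ in }\Omega,\qquad u=0\ \text{ on }\partial\Omega, \tag{2}$$ where $\partial\Omega=\{y\notin\Omega:\ y\sim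 x\text{ for some }x\in\Omega\}$. Let $H^1(\mathbb Z^3)$ be the completion of the finitely supported functions under $\|u\|_{H^1}^2=\int_{\mathbb Z^3}(|\nabla u|^2+u^2)\,d\mu$, let $\mathcal H_\lambda=\{u\in H^1(\mathbb Z^3):\int_{\mathbb Z^3}\lambda h u^2d\mu<\infty\}$, and let $H^1_0(\Omega)$ be the space of functions on $\Omega$, extended by zero to $\mathbb Z^3$. Define $J_\lambda$ on $\mathcal H_\lambda$ and $J_\Omega$ on $H_0^1(\Omega)$ by $$J_\lambda(u)=\tfrac12\int_{\mathbb Z^3}\big(a|\nabla u|^2+(\lambda h+1)u^2\big)d\mu+\tfrac b4\Big(\int_{\mathbb Z^3}|\nabla u|^2d\mu\Big)^2+\tfrac2{p^2}\int_{\mathbb Z^3}|u|^pd\mu-\tfrac1p\int_{\mathbb Z^3}|u|^p\log u^2d\mu,$$ $$J_\Omega(u)=\tfrac12\int_{\Omega\cup\partial\Omega}a|\nabla u|^2d\mu+\tfrac12\int_\Omega u^2d\mu+\tfrac b4\Big(\int_{\Omega\cup\partial\Omega}|\nabla u|^2d\mu\Big)^2+\tfrac2{p^2}\int_\Omega|u|^pd\mu-\tfrac1p\int_\Omega|u|^p\log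 u^2d\mu.$$ With $u^+=\max\{u,0\}$ and $u^-=\min\{u,0\}$, let $$m_\lambda=\inf\{J_\lambda(u):u\in\mathcal H_\lambda,\ u^\pm\ne0,\ (J_\lambda'(u),u^+)=(J_\lambda'(u),u^-)=0\},$$ and let $m_\Omega$ be defined in the same way from $J_\Omega$ and $H_0^1(\Omega)$. A *least energy sign-changing solution* of (1) is a weak solution $u\in\mathcal H_\lambda$ (that is, $(J_\lambda'(u),\varphi)=0$ for all $\varphi\in\mathcal H_\lambda$) with $u^\pm\neq0$ and $J_\lambda(u)=m_\lambda$; likewise for (2), with $H^1_0(\Omega)$, $J_\Omega$, $m_\Omega$. Then $m_\lambda\to m_\Omega$ as $\lambda\to\infty$. Moreover, if $\lambda_k\to\infty$ and, for all sufficiently large $k$, $u_k$ is a least energy sign-changing solution of (1) with $\lambda=\lambda_k$, then there are a subsequence $(u_{k_j})$ and a least energy sign-changing solution $u_0$ of (2) such that $\|u_{k_j}-u_0\|_{H^1}\to0$. -/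

import Mathlib

noncomputable section

namespace LogKirchhoff

/-- The vertex set `ℤ³`. -/
abbrev V : Type := Fin 3 → ℤ

/-- The integer lattice graph: `x ∼ y` iff `∑ᵢ |xᵢ - yᵢ| = 1`. -/
def lattice : SimpleGraph V where
  Adj x y := ∑ i, |x i - y i| = 1
  symm := ⟨fun x y hxy => by simpa only [abs_sub_comm] using hxy⟩
  loopless := ⟨fun x hx => by simp at hx⟩

/-- The (finite) set of neighbours of a vertex, see `mem_nbr`. -/
def nbr (x : V) : Finset V :=
  (Finset.Icc (x - 1) (x + 1)).filter fun y => ∑ i, |x i - y i| = 1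

theorem mem_nbr {x y : V} : y ∈ nbr x ↔ lattice.Adj x y := by
  constructor
  · intro hy
    exact (Finset.mem_filter.1 hy).2
  · intro hxy
    have hxy' : ∑ i, |x i - y i| = 1 := hxy
    have key : ∀ i, |x i - y i| ≤ 1 := fun i =>
      hxy' ▸ Finset.single_le_sum (f := fun i => |x i - y i|)
        (fun j _ => abs_nonneg _) (Finset.mem_univ i)
    refine Finset.mem_filter.2 ⟨Finset.mem_Icc.2 ⟨fun i => ?_, fun i => ?_⟩, hxy'⟩
    · have h1 := (abs_le.1 (key i)).2
      simp only [Pi.sub_apply, Pi.one_apply]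
      omega
    · have h1 := (abs_le.1 (key i)).1
      simp only [Pi.add_apply, Pi.one_apply]
      omega

/-- The gradient form `(∇u ∇v)(x) = ½ ∑_{y ∼ x} (u(y) - u(x)) (v(y) - v(x))`.
In particular `|∇u|²(x) = gradForm u u x`. -/
def gradForm (u v : V → ℝ) (x : V) : ℝ :=
  1 / 2 * ∑ y ∈ nbr x, (u y - u x) * (v y - v x)

/-- `u⁺ = max {u, 0}`. -/
def uPlus (u : V → ℝ) : V → ℝ := fun x => max (u x) 0

/-- `u⁻ = min {u, 0}` (a nonpositive function). -/
def uMinus (u : V → ℝ) : V → ℝ := fun x => min (u x) 0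

/-! ### Function spaces -/

/-- `H¹(ℤ³)`: the functions with `∑ (|∇u|² + u²) < ∞`. Finitely supported functions are dense
among them in the norm `normH1`, and they are complete for it, so this is the completion of
`C_c(ℤ³)`. -/
def H1 : Set (V → ℝ) := {u | Summable fun x => gradForm u u x + u x ^ 2}

/-- The norm of `H¹(ℤ³)`. -/
def normH1 (u : V → ℝ) : ℝ := Real.sqrt (∑' x, (gradForm u u x + u x ^ 2))

/-- The space `ℋ_λ = {u ∈ H¹(ℤ³) : ∑ λ h u² < ∞}`. -/
def HLam (h : V → ℝ) (lam : ℝ) : Set (V → ℝ) :=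
  {u | u ∈ H1 ∧ Summable fun x => lam * h x * u x ^ 2}

/-- The potential well `{x : h(x) = 0}`. -/
def well (h : V → ℝ) : Set V := {x | h x = 0}

/-- The vertex boundary `∂Ω`: vertices outside `Ω` with a neighbour in `Ω`. -/
def vertexBoundary (Ω : Set V) : Set V := {y | y ∉ Ω ∧ ∃ x ∈ Ω, lattice.Adj x y}

/-- `H¹₀(Ω)`: the `H¹` functions that vanish off `Ω`. For a finite set `Ω` these are exactly the
functions on `Ω`, extended by zero. -/
def H10 (Ω : Set V) : Set (V → ℝ) := {u | u ∈ H1 ∧ ∀ x ∉ Ω, u x = 0}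

/-! ### The equation on `ℤ³` -/

/-- The energy functional `J_λ`. -/
def J (a b p : ℝ) (h : V → ℝ) (lam : ℝ) (u : V → ℝ) : ℝ :=
  1 / 2 * ∑' x, (a * gradForm u u x + (lam * h x + 1) * u x ^ 2)
    + b / 4 * (∑' x, gradForm u u x) ^ 2
    + 2 / p ^ 2 * ∑' x, |u x| ^ p
    - 1 / p * ∑' x, |u x| ^ p * Real.log (u x ^ 2)

/-- The derivative pairing `(J_λ'(u), φ)`. -/
def dJ (a b p : ℝ) (h : V → ℝ) (lam : ℝ) (u φ : V → ℝ) : ℝ :=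
  ∑' x, (a * gradForm u φ x + (lam * h x + 1) * u x * φ x)
    + b * (∑' x, gradForm u u x) * ∑' x, gradForm u φ x
    - ∑' x, |u x| ^ (p - 2) * u x * φ x * Real.log (u x ^ 2)

/-- Sign-changing (weak) solutions of
`-(a + b ∫ |∇u|²) Δu + (λ h + 1) u = |u|^{p-2} u log u²` on `ℤ³`. -/
def IsSignChangingSol (a b p : ℝ) (h : V → ℝ) (lam : ℝ) (u : V → ℝ) : Prop :=
  u ∈ HLam h lam ∧ (∀ φ ∈ HLam h lam, dJ a b p h lam u φ = 0) ∧ uPlus u ≠ 0 ∧ uMinus u ≠ 0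

/-- The sign-changing Nehari set `ℳ_λ`. -/
def nehariSC (a b p : ℝ) (h : V → ℝ) (lam : ℝ) : Set (V → ℝ) :=
  {u | u ∈ HLam h lam ∧ uPlus u ≠ 0 ∧ uMinus u ≠ 0 ∧
    dJ a b p h lam u (uPlus u) = 0 ∧ dJ a b p h lam u (uMinus u) = 0}

/-- `m_λ = inf_{ℳ_λ} J_λ`. -/
def mLam (a b p : ℝ) (h : V → ℝ) (lam : ℝ) : ℝ :=
  sInf (J a b p h lam '' nehariSC a b p h lam)

/-- Least energy sign-changing solutions of the equation on `ℤ³`. -/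
def IsLeastEnergySol (a b p : ℝ) (h : V → ℝ) (lam : ℝ) (u : V → ℝ) : Prop :=
  IsSignChangingSol a b p h lam u ∧ J a b p h lam u = mLam a b p h lam

/-! ### The limiting Dirichlet problem on `Ω` -/

/-- The energy functional `J_Ω`. -/
def JΩ (a b p : ℝ) (Ω : Set V) (u : V → ℝ) : ℝ :=
  1 / 2 * ∑' x : ↥(Ω ∪ vertexBoundary Ω), a * gradForm u u x
    + 1 / 2 * ∑' x : ↥Ω, u x ^ 2
    + b / 4 * (∑' x : ↥(Ω ∪ vertexBoundary Ω), gradForm u u x) ^ 2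
    + 2 / p ^ 2 * ∑' x : ↥Ω, |u x| ^ p
    - 1 / p * ∑' x : ↥Ω, |u x| ^ p * Real.log (u x ^ 2)

/-- The derivative pairing `(J_Ω'(u), φ)`. -/
def dJΩ (a b p : ℝ) (Ω : Set V) (u φ : V → ℝ) : ℝ :=
  ∑' x : ↥(Ω ∪ vertexBoundary Ω), a * gradForm u φ x
    + ∑' x : ↥Ω, u x * φ x
    + b * (∑' x : ↥(Ω ∪ vertexBoundary Ω), gradForm u u x)
        * ∑' x : ↥(Ω ∪ vertexBoundary Ω), gradForm u φ x
    - ∑' x : ↥Ω, |u x| ^ (p - 2) * u x * φ x * Real.log (u x ^ 2)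

/-- Sign-changing (weak) solutions of
`-(a + b ∫_{Ω ∪ ∂Ω} |∇u|²) Δu + u = |u|^{p-2} u log u²` in `Ω`, `u = 0` on `∂Ω`. -/
def IsSignChangingSolΩ (a b p : ℝ) (Ω : Set V) (u : V → ℝ) : Prop :=
  u ∈ H10 Ω ∧ (∀ φ ∈ H10 Ω, dJΩ a b p Ω u φ = 0) ∧ uPlus u ≠ 0 ∧ uMinus u ≠ 0

/-- The sign-changing Nehari set `ℳ_Ω`. -/
def nehariSCΩ (a b p : ℝ) (Ω : Set V) : Set (V → ℝ) :=
  {u | u ∈ H10 Ω ∧ uPlus u ≠ 0 ∧ uMinus u ≠ 0 ∧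
    dJΩ a b p Ω u (uPlus u) = 0 ∧ dJΩ a b p Ω u (uMinus u) = 0}

/-- `m_Ω = inf_{ℳ_Ω} J_Ω`. -/
def mΩ (a b p : ℝ) (Ω : Set V) : ℝ := sInf (JΩ a b p Ω '' nehariSCΩ a b p Ω)

/-- Least energy sign-changing solutions of the Dirichlet problem on `Ω`. -/
def IsLeastEnergySolΩ (a b p : ℝ) (Ω : Set V) (u : V → ℝ) : Prop :=
  IsSignChangingSolΩ a b p Ω u ∧ JΩ a b p Ω u = mΩ a b p Ω

end LogKirchhoff

end

open LogKirchhoff Filter Topology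

namespace LogKirchhoff

/-! Every vertex has the same finite number of neighbours, so the Dirichlet energy is controlled by
the `ℓ²` norm and `H1` is just `ℓ²`. Two ingredients carry the proof.

Fibering. The energy of `s u⁺ + t u⁻` is an explicit function `fib` of `(s, t)`, and the two Nehari
constraints say that its partial derivatives vanish. The interaction term `∫ ∇u⁺∇u⁻` is nonnegative.
For `p ≥ 4` a critical point at `(1, 1)` is a global maximum over the closed quadrant
(`fib_le_fib_one`), and every sign-changing function has a critical point in the open quadrant
(`exists_critical_fib`). Hence every sign-changing function projects onto the Nehari set, and on
that set `J` can only drop along the fiber.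

Compactness. On the Nehari set, `J` bounds a quarter of `∫ (λh + 1)u²`. Along `λ_k → ∞` with bounded
energy, a diagonal subsequence converges pointwise, the mass off the finite set `{h < M}` is
`O(1/λ_k)`, and the limit vanishes off the well. So convergence is strong (`TailConv`). The limit
keeps both signs, because a Nehari function exceeds `1` somewhere and lies below `-1` somewhere:
otherwise the logarithmic term could not balance the positive terms.

Extension by zero preserves energies and constraints, so `m_λ ≤ m_Ω`. Conversely, let
near-minimisers `u_k` tend to `u₀`, and project `u₀` onto `ℳ_Ω` with coefficients `s, t`. Then `m_Ω
≤ J_0(s u₀⁺ + t u₀⁻) = lim J_0(s u_k⁺ + t u_k⁻)`, and each term on the right is at most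
`J_{λ_k}(u_k)` by fibering. For solutions, the weak equation tested on functions supported in the
well also passes to the limit, and the same inequalities identify the energy of `u₀` as `m_Ω`. -/

/-! ### Square-summable functions on the lattice -/

theorem sum_nbr (w : V → ℝ) (x : V) : ∑ y ∈ nbr x, w y = ∑ e ∈ nbr 0, w (x + e) := by
  refine Finset.sum_nbij' (fun y => y - x) (fun e => x + e) ?_ ?_ ?_ ?_ ?_
  · intro y hy
    rw [mem_nbr] at hy ⊢
    have hy' : ∑ i, |x i - y i| = 1 := hy
    show ∑ i, |(0 : V) i - (y - x) i| = 1
    rw [← hy']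
    refine Finset.sum_congr rfl fun i _ => ?_
    congr 1
    simp
  · intro e he
    rw [mem_nbr] at he ⊢
    have he' : ∑ i, |(0 : V) i - e i| = 1 := he
    show ∑ i, |x i - (x + e) i| = 1
    rw [← he']
    refine Finset.sum_congr rfl fun i _ => ?_
    congr 1
    simp
  · intro y _; simp
  · intro e _; simp
  · intro y _; simp

theorem card_nbr (x : V) : ((nbr x).card : ℝ) = (nbr 0).card := by
  simpa using sum_nbr (fun _ => 1) x

/-- The sum of `w y + w x` over the edges `y ∼ x`. -/
noncomputable def edgeSum (w : V → ℝ) (x : V) : ℝ := ∑ y ∈ nbr x, (w y + w x)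

/-- Neighbours are translates by a fixed finite set, and each translation merely reindexes the sum.
-/
theorem hasSum_edgeSum {w : V → ℝ} (hw : Summable w) :
    HasSum (edgeSum w) (2 * (nbr 0).card * ∑' x, w x) := by
  have h1 : HasSum (fun x => ∑ e ∈ nbr 0, w (x + e)) (∑ e ∈ nbr 0, ∑' x, w x) :=
    hasSum_sum fun e _ => (Equiv.addRight e).hasSum_iff.2 hw.hasSum
  have h2 : HasSum (fun x => ((nbr 0).card : ℝ) * w x) ((nbr 0).card * ∑' x, w x) :=
    hw.hasSum.mul_left _
  convert h1.add h2 using 1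
  · funext x
    rw [edgeSum, Finset.sum_add_distrib, sum_nbr, Finset.sum_const, nsmul_eq_mul, card_nbr]
  · rw [Finset.sum_const, nsmul_eq_mul]; ring

theorem abs_gradForm_le (u v : V → ℝ) (x : V) :
    |gradForm u v x| ≤ edgeSum (fun y => u y ^ 2 + v y ^ 2) x := by
  rw [gradForm, abs_mul, edgeSum, abs_of_pos (by norm_num : (0 : ℝ) < 1 / 2)]
  have key : |∑ y ∈ nbr x, (u y - u x) * (v y - v x)|
      ≤ ∑ y ∈ nbr x, (u y ^ 2 + v y ^ 2 + (u x ^ 2 + v x ^ 2)) := by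
    refine (Finset.abs_sum_le_sum_abs _ _).trans (Finset.sum_le_sum fun y _ => ?_)
    rw [abs_le]
    constructor <;>
    nlinarith [sq_nonneg (u y - u x + (v y - v x)), sq_nonneg (u y - u x - (v y - v x)),
      sq_nonneg (u y + u x), sq_nonneg (v y + v x)]
  have := abs_nonneg (∑ y ∈ nbr x, (u y - u x) * (v y - v x))
  linarith

theorem summable_gradForm {u v : V → ℝ} (hu : Summable fun x => u x ^ 2)
    (hv : Summable fun x => v x ^ 2) : Summable fun x => gradForm u v x :=
  Summable.of_norm_bounded (hasSum_edgeSum (hu.add hv)).summable fun x => abs_gradForm_le u v x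

theorem gradForm_self_nonneg (u : V → ℝ) (x : V) : 0 ≤ gradForm u u x :=
  mul_nonneg (by norm_num) (Finset.sum_nonneg fun _ _ => mul_self_nonneg _)

theorem mem_H1 {u : V → ℝ} : u ∈ H1 ↔ Summable fun x => u x ^ 2 := by
  refine ⟨fun h => Summable.of_nonneg_of_le (fun x => sq_nonneg _)
    (fun x => ?_) h, fun h => (summable_gradForm h h).add h⟩
  linarith [gradForm_self_nonneg u x]

theorem rpow_le_sq {p t : ℝ} (hp : 2 ≤ p) (ht : |t| ≤ 1) : |t| ^ p ≤ t ^ 2 := by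
  have := Real.rpow_le_rpow_of_exponent_ge' (abs_nonneg t) ht (by norm_num) hp
  simpa using this

/-- One factor `|t|` absorbs the logarithm, since `|t log t| < 1` on `(0, 1]`; the remaining power
is at least `2`. -/
theorem abs_rpow_mul_log_le {p t : ℝ} (hp : 3 ≤ p) (ht : |t| ≤ 1) :
    |(|t| ^ p * Real.log (t ^ 2))| ≤ 2 * t ^ 2 := by
  rcases eq_or_ne t 0 with rfl | h0
  · simp
  have hpos : 0 < |t| := abs_pos.2 h0
  have h1 : |t| ^ p ≤ |t| ^ (3 : ℝ) :=
    Real.rpow_le_rpow_of_exponent_ge' (abs_nonneg t) ht (by norm_num) hp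
  have h2 : |t| ^ (3 : ℝ) = t ^ 2 * |t| := by
    rw [← sq_abs t]; norm_cast
  have h3 : Real.log (t ^ 2) = 2 * Real.log (abs t) := by
    rw [← sq_abs, Real.log_pow]; norm_num
  have h4 : abs (Real.log (abs t) * abs t) < 1 := Real.abs_log_mul_self_lt |t| hpos ht
  rw [abs_mul, abs_abs] at h4
  rw [abs_mul, h3, abs_mul, abs_of_nonneg (Real.rpow_nonneg (abs_nonneg t) p), abs_two]
  calc |t| ^ p * (2 * abs (Real.log (abs t))) ≤ (t ^ 2 * |t|) * (2 * abs (Real.log (abs t))) := by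
        gcongr; exact h1.trans h2.le
    _ = 2 * t ^ 2 * (abs (Real.log (abs t)) * |t|) := by ring
    _ ≤ 2 * t ^ 2 * 1 := by gcongr
    _ = 2 * t ^ 2 := mul_one _

theorem eventually_abs_le_one {u : V → ℝ} (hu : Summable fun x => u x ^ 2) :
    ∀ᶠ x in cofinite, |u x| ≤ 1 := by
  filter_upwards [hu.tendsto_cofinite_zero.eventually_lt_const one_pos] with x hx
  exact (sq_le_one_iff_abs_le_one _).1 hx.le

theorem summable_rpow {p : ℝ} (hp : 2 ≤ p) {u : V → ℝ} (hu : Summable fun x => u x ^ 2) :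
    Summable fun x => |u x| ^ p := by
  refine Summable.of_norm_bounded_eventually hu ?_
  filter_upwards [eventually_abs_le_one hu] with x hx
  rw [Real.norm_of_nonneg (Real.rpow_nonneg (abs_nonneg _) _)]
  exact rpow_le_sq hp hx

theorem summable_rpow_mul_log {p : ℝ} (hp : 3 ≤ p) {u : V → ℝ} (hu : Summable fun x => u x ^ 2) :
    Summable fun x => |u x| ^ p * Real.log (u x ^ 2) := by
  refine Summable.of_norm_bounded_eventually (hu.mul_left 2) ?_
  filter_upwards [eventually_abs_le_one hu] with x hx
  exact abs_rpow_mul_log_le hp hx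

/-! ### Strong convergence from vanishing tails -/

/-- Convergence of series whose terms are dominated, off a finite set, by series tending to `0`. -/
theorem tendsto_tsum_of_tail {f g : ℕ → V → ℝ} {f₀ : V → ℝ} (T : Finset V)
    (hf : ∀ x ∈ T, Tendsto (fun k => f k x) atTop (𝓝 (f₀ x))) (hf₀ : ∀ x ∉ T, f₀ x = 0)
    (hfg : ∀ᶠ k in atTop, ∀ x ∉ T, |f k x| ≤ g k x) (hg0 : ∀ k x, 0 ≤ g k x)
    (hg : ∀ k, Summable (g k)) (hg' : Tendsto (fun k => ∑' x, g k x) atTop (𝓝 0)) :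
    Tendsto (fun k => ∑' x, f k x) atTop (𝓝 (∑' x, f₀ x)) := by
  rw [tsum_eq_sum fun x hx => hf₀ x hx]
  have h1 := tendsto_finsetSum T hf
  have hbd : ∀ᶠ k in atTop, ∀ x, ‖f k x - (if x ∈ T then f k x else 0)‖ ≤ g k x := by
    filter_upwards [hfg] with k hk x
    by_cases hx : x ∈ T
    · simpa [hx] using hg0 k x
    · simpa [hx] using hk x hx
  have h2 : Tendsto (fun k => ∑' x, (f k x - (if x ∈ T then f k x else 0))) atTop (𝓝 0) := by
    refine squeeze_zero_norm' ?_ hg'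
    filter_upwards [hbd] with k hk
    exact tsum_of_norm_bounded (hg k).hasSum hk
  have h3 := h1.add h2
  rw [add_zero] at h3
  refine h3.congr' ?_
  filter_upwards [hbd] with k hk
  have hs : Summable fun x => f k x - (if x ∈ T then f k x else 0) :=
    Summable.of_norm_bounded (hg k) hk
  have hs' : HasSum (fun x => if x ∈ T then f k x else 0) (∑ x ∈ T, f k x) := by
    have : HasSum (fun x => if x ∈ T then f k x else 0) (∑ x ∈ T, if x ∈ T then f k x else 0) :=
      hasSum_sum_of_ne_finset_zero fun x hx => if_neg hx
    rwa [Finset.sum_congr rfl fun x hx => if_pos hx] at this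
  have := (hs'.add hs.hasSum).tsum_eq
  simpa using this.symm

/-- The squares of `u`, set to zero on `T`. -/
noncomputable def tailSq (T : Finset V) (u : V → ℝ) (x : V) : ℝ := if x ∈ T then 0 else u x ^ 2

theorem tailSq_nonneg (T : Finset V) (u : V → ℝ) (x : V) : 0 ≤ tailSq T u x := by
  unfold tailSq; split_ifs <;> positivity

theorem tailSq_le (T : Finset V) (u : V → ℝ) (x : V) : tailSq T u x ≤ u x ^ 2 := by
  unfold tailSq; split_ifs <;> [positivity; rfl]

theorem summable_tailSq (T : Finset V) {u : V → ℝ} (hu : Summable fun x => u x ^ 2) :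
    Summable (tailSq T u) :=
  Summable.of_nonneg_of_le (tailSq_nonneg T u) (tailSq_le T u) hu

/-- Pointwise convergence of square-summable functions to a function supported in the finite
set `T`, with the mass off `T` vanishing in the limit. -/
structure TailConv (T : Finset V) (u : ℕ → V → ℝ) (u₀ : V → ℝ) : Prop where
  summable_sq : ∀ k, Summable fun x => u k x ^ 2
  tendsto_apply : ∀ x, Tendsto (fun k => u k x) atTop (𝓝 (u₀ x))
  eq_zero : ∀ x ∉ T, u₀ x = 0
  tail : Tendsto (fun k => ∑' x, tailSq T (u k) x) atTop (𝓝 0)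

namespace TailConv

variable {T : Finset V} {u v : ℕ → V → ℝ} {u₀ v₀ : V → ℝ}

theorem limit_summable_sq (H : TailConv T u u₀) : Summable fun x => u₀ x ^ 2 :=
  summable_of_ne_finset_zero (s := T) fun x hx => by simp [H.eq_zero x hx]

theorem of_abs_le (H : TailConv T u u₀) (C : ℝ)
    (hle : ∀ k x, |v k x| ≤ C * |u k x|)
    (hv : ∀ x, Tendsto (fun k => v k x) atTop (𝓝 (v₀ x))) : TailConv T v v₀ := by
  have hsq : ∀ k x, v k x ^ 2 ≤ C ^ 2 * u k x ^ 2 := fun k x => by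
    rw [← sq_abs, ← sq_abs (u k x), ← mul_pow]
    exact pow_le_pow_left₀ (abs_nonneg _) (hle k x) 2
  have hs : ∀ k, Summable fun x => v k x ^ 2 := fun k =>
    Summable.of_nonneg_of_le (fun x => sq_nonneg _) (hsq k) ((H.summable_sq k).mul_left _)
  refine ⟨hs, hv, fun x hx => ?_, ?_⟩
  · refine tendsto_nhds_unique (hv x) (squeeze_zero_norm (fun k => hle k x) ?_)
    simpa [H.eq_zero x hx] using ((H.tendsto_apply x).abs.const_mul C)
  · refine squeeze_zero (fun k => tsum_nonneg (tailSq_nonneg T _)) (fun k => ?_)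
      (by simpa using H.tail.const_mul (C ^ 2))
    rw [← tsum_mul_left]
    refine (summable_tailSq T (hs k)).tsum_le_tsum (fun x => ?_)
      ((summable_tailSq T (H.summable_sq k)).mul_left _)
    unfold tailSq
    split_ifs
    · simp
    · exact hsq k x

theorem neg (H : TailConv T u u₀) : TailConv T (fun k x => -u k x) fun x => -u₀ x :=
  H.of_abs_le 1 (fun k x => by simp) fun x => (H.tendsto_apply x).neg

theorem sub_limit (H : TailConv T u u₀) : TailConv T (fun k => u k - u₀) 0 := by
  refine ⟨fun k => ?_, fun x => ?_, fun x _ => rfl, ?_⟩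
  · refine Summable.of_nonneg_of_le (fun x => sq_nonneg _) (fun x => ?_)
      (((H.summable_sq k).mul_left 2).add (H.limit_summable_sq.mul_left 2))
    simp only [Pi.sub_apply]
    nlinarith [sq_nonneg (u k x + u₀ x)]
  · simpa using (H.tendsto_apply x).sub_const (u₀ x)
  · refine H.tail.congr fun k => tsum_congr fun x => ?_
    unfold tailSq
    split_ifs with hx
    · rfl
    · simp [H.eq_zero x hx]

theorem eventually_abs_le_one (H : TailConv T u u₀) :
    ∀ᶠ k in atTop, ∀ x ∉ T, |u k x| ≤ 1 := by
  filter_upwards [H.tail.eventually_lt_const one_pos] with k hk x hx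
  have h1 := (summable_tailSq T (H.summable_sq k)).le_tsum x fun y _ => tailSq_nonneg T _ y
  rw [tailSq, if_neg hx] at h1
  exact (sq_le_one_iff_abs_le_one _).1 (h1.trans hk.le)

/-- Eventually `|u k| ≤ 1` off `T`, so values above `1` must occur on the finite set `T`, where
pointwise convergence is uniform. This prevents either sign from disappearing in the limit. -/
theorem exists_limit_pos (H : TailConv T u u₀) (h1 : ∀ k, ∃ x, 1 < u k x) : ∃ x, 0 < u₀ x := by
  by_contra! hneg
  have h2 : ∀ᶠ k in atTop, ∀ x ∈ T, u k x < 1 :=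
    (Finset.eventually_all T).2 fun x _ =>
      (H.tendsto_apply x).eventually_lt_const ((hneg x).trans_lt one_pos)
  obtain ⟨k, hk, hk'⟩ := (h2.and H.eventually_abs_le_one).exists
  obtain ⟨x, hx⟩ := h1 k
  by_cases hxT : x ∈ T
  · exact lt_asymm hx (hk x hxT)
  · exact absurd hx (not_lt.2 ((le_abs_self _).trans (hk' x hxT)))

theorem tendsto_gradForm (H : TailConv T u u₀) :
    Tendsto (fun k => ∑' x, gradForm (u k) (u k) x) atTop (𝓝 (∑' x, gradForm u₀ u₀ x)) := by
  -- The gradient at `x` also sees the neighbours of `x`, so the exceptional set is `T` enlarged by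
  -- one layer.
  have hnb : ∀ x ∉ T ∪ T.biUnion nbr, x ∉ T ∧ ∀ y ∈ nbr x, y ∉ T := by
    intro x hx
    simp only [Finset.mem_union, Finset.mem_biUnion, not_or, not_exists, not_and] at hx
    exact ⟨hx.1, fun y hy hyT => hx.2 y hyT (mem_nbr.2 (mem_nbr.1 hy).symm)⟩
  have hsum : ∀ k, HasSum (edgeSum fun x => 2 * tailSq T (u k) x) _ := fun k =>
    hasSum_edgeSum ((summable_tailSq T (H.summable_sq k)).mul_left 2)
  refine tendsto_tsum_of_tail (g := fun k => edgeSum fun x => 2 * tailSq T (u k) x)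
    (T ∪ T.biUnion nbr) (fun x _ => ?_) (fun x hx => ?_)
    (Eventually.of_forall fun k x hx => ?_) (fun k x => ?_) (fun k => (hsum k).summable) ?_
  · exact (tendsto_finsetSum _ fun y _ =>
      ((H.tendsto_apply y).sub (H.tendsto_apply x)).mul
        ((H.tendsto_apply y).sub (H.tendsto_apply x))).const_mul _
  · obtain ⟨hx, hy⟩ := hnb x hx
    rw [gradForm, Finset.sum_eq_zero, mul_zero]
    intro y hyx
    rw [H.eq_zero x hx, H.eq_zero y (hy y hyx)]
    simp
  · obtain ⟨hx, hy⟩ := hnb x hx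
    refine (abs_gradForm_le _ _ x).trans (Finset.sum_le_sum fun y hyx => le_of_eq ?_)
    simp only [tailSq, if_neg hx, if_neg (hy y hyx)]
    ring
  · exact Finset.sum_nonneg fun y _ => add_nonneg
      (mul_nonneg two_pos.le (tailSq_nonneg _ _ _)) (mul_nonneg two_pos.le (tailSq_nonneg _ _ _))
  · simp_rw [fun k => (hsum k).tsum_eq, tsum_mul_left]
    simpa using (H.tail.const_mul 2).const_mul (2 * ((nbr 0).card : ℝ))

theorem tendsto_local (H : TailConv T u u₀) {φ : ℝ → ℝ} (hφ : Continuous φ) {C : ℝ} (hC : 0 ≤ C)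
    (hle : ∀ t, |t| ≤ 1 → |φ t| ≤ C * t ^ 2) :
    Tendsto (fun k => ∑' x, φ (u k x)) atTop (𝓝 (∑' x, φ (u₀ x))) := by
  refine tendsto_tsum_of_tail (g := fun k x => C * tailSq T (u k) x) T
    (fun x _ => (hφ.tendsto _).comp (H.tendsto_apply x)) (fun x hx => ?_) ?_
    (fun k x => mul_nonneg hC (tailSq_nonneg _ _ _))
    (fun k => (summable_tailSq T (H.summable_sq k)).mul_left C) ?_
  · simpa [H.eq_zero x hx] using hle 0 (by simp)
  · filter_upwards [H.eventually_abs_le_one] with k hk x hx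
    simpa [tailSq, hx] using hle _ (hk x hx)
  · simp_rw [tsum_mul_left]
    simpa using H.tail.const_mul C

theorem tendsto_sq (H : TailConv T u u₀) :
    Tendsto (fun k => ∑' x, u k x ^ 2) atTop (𝓝 (∑' x, u₀ x ^ 2)) :=
  H.tendsto_local (φ := fun t => t ^ 2) (by fun_prop) zero_le_one fun t _ => by simp

theorem tendsto_rpow (H : TailConv T u u₀) {p : ℝ} (hp : 2 ≤ p) :
    Tendsto (fun k => ∑' x, |u k x| ^ p) atTop (𝓝 (∑' x, |u₀ x| ^ p)) :=
  H.tendsto_local (φ := fun t => |t| ^ p) 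
    (Continuous.rpow_const continuous_abs fun _ => Or.inr (by linarith)) zero_le_one fun t ht => by
      rw [abs_of_nonneg (Real.rpow_nonneg (abs_nonneg _) _), one_mul]
      exact rpow_le_sq hp ht

end TailConv

/-- Reduces the nonlinearity to `x log x` at `x = |t| ^ p`, which is continuous and bounded below by
`x - 1`. At `t = 0` the convention `log 0 = 0` is the right value. -/
theorem rpow_mul_log_eq {p : ℝ} (hp : 0 < p) (t : ℝ) :
    |t| ^ p * Real.log (t ^ 2) = 2 / p * (|t| ^ p * Real.log (|t| ^ p)) := by
  rcases eq_or_ne t 0 with rfl | h0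
  · simp [hp.ne']
  · rw [Real.log_rpow (abs_pos.2 h0), ← sq_abs, Real.log_pow]
    push_cast
    field_simp

theorem continuous_rpow_mul_log {p : ℝ} (hp : 0 < p) :
    Continuous fun t : ℝ => |t| ^ p * Real.log (t ^ 2) := by
  simp_rw [rpow_mul_log_eq hp]
  exact continuous_const.mul (Real.continuous_mul_log.comp
    (Continuous.rpow_const continuous_abs fun _ => Or.inr hp.le))

theorem TailConv.tendsto_rpow_mul_log {T : Finset V} {u : ℕ → V → ℝ} {u₀ : V → ℝ}
    (H : TailConv T u u₀) {p : ℝ} (hp : 3 ≤ p) :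
    Tendsto (fun k => ∑' x, |u k x| ^ p * Real.log (u k x ^ 2)) atTop
      (𝓝 (∑' x, |u₀ x| ^ p * Real.log (u₀ x ^ 2))) :=
  H.tendsto_local (continuous_rpow_mul_log (by linarith)) two_pos.le
    fun _ ht => abs_rpow_mul_log_le hp ht

/-! ### The two-parameter fibering map -/

/-- The energy `J_λ(s v + t w)` of two functions with disjoint supports, as a function of `s, t`. -/
noncomputable def fib (a b p A B D g₁ g₂ P₁ P₂ L₁ L₂ s t : ℝ) : ℝ :=
  1 / 2 * (s ^ 2 * A + t ^ 2 * B + 2 * s * t * (a * D))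
    + b / 4 * (s ^ 2 * g₁ + t ^ 2 * g₂ + 2 * s * t * D) ^ 2
    + 2 / p ^ 2 * (s ^ p * P₁ + t ^ p * P₂)
    - 1 / p * (s ^ p * (L₁ + Real.log (s ^ 2) * P₁) + t ^ p * (L₂ + Real.log (t ^ 2) * P₂))

/-- The partial derivative of `fib` in its variable `s`. -/
noncomputable def fibDeriv (a b p A D g₁ g₂ P₁ L₁ s t : ℝ) : ℝ :=
  s * A + t * (a * D) + b * (s ^ 2 * g₁ + t ^ 2 * g₂ + 2 * s * t * D) * (s * g₁ + t * D)
    - s ^ (p - 1) * (L₁ + Real.log (s ^ 2) * P₁)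

theorem fib_comm (a b p A B D g₁ g₂ P₁ P₂ L₁ L₂ s t : ℝ) :
    fib a b p A B D g₁ g₂ P₁ P₂ L₁ L₂ s t = fib a b p B A D g₂ g₁ P₂ P₁ L₂ L₁ t s := by
  unfold fib; ring

/-- The coefficient `2 / p ^ 2` is chosen so that the derivative of `s ^ p` cancels the one coming
from `log (s ^ 2)`. -/
theorem hasDerivAt_fib (a b p A B D g₁ g₂ P₁ P₂ L₁ L₂ t : ℝ) (hp : 0 < p) {s : ℝ} (hs : 0 < s) :
    HasDerivAt (fun s => fib a b p A B D g₁ g₂ P₁ P₂ L₁ L₂ s t)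
      (fibDeriv a b p A D g₁ g₂ P₁ L₁ s t) s := by
  have hid := hasDerivAt_id' s
  have h2 := hid.pow 2
  have hq := ((h2.mul_const A).add_const (t ^ 2 * B)).add (((hid.const_mul 2).mul_const t).mul_const
    (a * D))
  have hg := ((h2.mul_const g₁).add_const (t ^ 2 * g₂)).add
    (((hid.const_mul 2).mul_const t).mul_const D)
  have hr : HasDerivAt (fun s : ℝ => s ^ p) (p * s ^ (p - 1)) s :=
    Real.hasDerivAt_rpow_const (Or.inl hs.ne')
  have hl := (h2.log (pow_ne_zero 2 hs.ne')).mul_const P₁ |>.const_add L₁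
  have := (((hq.const_mul (1 / 2)).add ((hg.pow 2).const_mul (b / 4))).add
    (((hr.mul_const P₁).add_const (t ^ p * P₂)).const_mul (2 / p ^ 2))).sub
    (((hr.mul hl).add_const (t ^ p * (L₂ + Real.log (t ^ 2) * P₂))).const_mul (1 / p))
  refine this.congr_deriv ?_
  have hsp : s ^ p = s ^ (p - 1) * s := by
    rw [← Real.rpow_add_one hs.ne']; ring_nf
  unfold fibDeriv
  simp only [hsp, Pi.add_apply, Pi.pow_apply]
  field_simp
  push_cast
  ring

/-- Bernoulli's inequality for the concave power `q / p`, applied to `s ^ p`. -/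
theorem one_sub_rpow_div_le {p q s : ℝ} (hq : 0 < q) (hqp : q ≤ p) (hs : 0 ≤ s) :
    (1 - s ^ p) / p ≤ (1 - s ^ q) / q := by
  have hp : 0 < p := hq.trans_le hqp
  have h := rpow_one_add_le_one_add_mul_self (s := s ^ p - 1) (p := q / p)
    (by linarith [Real.rpow_nonneg hs p]) (by positivity) ((div_le_one hp).2 hqp)
  rw [show 1 + (s ^ p - 1) = s ^ p by ring, ← Real.rpow_mul hs,
    mul_div_cancel₀ _ hp.ne'] at h
  rw [div_le_div_iff₀ hp hq]
  have : p * s ^ q ≤ p * (1 + q / p * (s ^ p - 1)) := by gcongr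
  have e : p * (1 + q / p * (s ^ p - 1)) = p + q * (s ^ p - 1) := by field_simp
  nlinarith

/-- The critical equations express `L₁`, `L₂` through the other data; after substitution the
difference is a sum of nonnegative terms, one for each of the quadratic, quartic and logarithmic
parts, plus squares. The quartic part is where `p ≥ 4` is needed. -/
theorem fib_le_fib_one {a b p A B D g₁ g₂ P₁ P₂ L₁ L₂ s t : ℝ} (ha : 0 ≤ a) (hb : 0 ≤ b)
    (hp : 4 ≤ p) (hA : 0 ≤ A) (hB : 0 ≤ B) (hD : 0 ≤ D) (hg₁ : 0 ≤ g₁) (hg₂ : 0 ≤ g₂)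
    (hP₁ : 0 ≤ P₁) (hP₂ : 0 ≤ P₂) (hs : 0 ≤ s) (ht : 0 ≤ t)
    (h₁ : fibDeriv a b p A D g₁ g₂ P₁ L₁ 1 1 = 0) (h₂ : fibDeriv a b p B D g₂ g₁ P₂ L₂ 1 1 = 0) :
    fib a b p A B D g₁ g₂ P₁ P₂ L₁ L₂ s t ≤ fib a b p A B D g₁ g₂ P₁ P₂ L₁ L₂ 1 1 := by
  have hp0 : 0 < p := by linarith
  have e₁ : L₁ = A + a * D + b * (g₁ + g₂ + 2 * D) * (g₁ + D) := by
    simp [fibDeriv] at h₁; linarith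
  have e₂ : L₂ = B + a * D + b * (g₁ + g₂ + 2 * D) * (g₂ + D) := by
    simp [fibDeriv] at h₂; linarith
  have hlog : ∀ r : ℝ, 0 ≤ r → 0 ≤ 2 / p ^ 2 * (1 - r ^ p) + 1 / p * (r ^ p * Real.log (r ^ 2)) := by
    intro r hr
    have hx : 0 ≤ r ^ p := Real.rpow_nonneg hr p
    have e := rpow_mul_log_eq hp0 r
    rw [abs_of_nonneg hr] at e
    have key : r ^ p - 1 ≤ r ^ p * Real.log (r ^ p) := by
      rcases hx.eq_or_lt with h0 | h0
      · rw [← h0]; simp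
      · have := Real.one_sub_inv_le_log_of_pos h0
        have := mul_le_mul_of_nonneg_left this hx
        rwa [mul_sub, mul_one, mul_inv_cancel₀ h0.ne'] at this
    rw [e]
    have : 2 / p ^ 2 * (1 - r ^ p) + 1 / p * (2 / p * (r ^ p * Real.log (r ^ p)))
        = 2 / p ^ 2 * (r ^ p * Real.log (r ^ p) - (r ^ p - 1)) := by field_simp; ring
    rw [this]
    exact mul_nonneg (by positivity) (by linarith)
  have h2 : ∀ r : ℝ, 0 ≤ r → 0 ≤ (1 - r ^ 2) / 2 - (1 - r ^ p) / p := fun r hr => by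
    have := one_sub_rpow_div_le (p := p) (q := 2) (by norm_num) (by linarith) hr
    rw [Real.rpow_two] at this
    linarith
  have h4 : ∀ r : ℝ, 0 ≤ r → 0 ≤ (1 - r ^ 4) / 4 - (1 - r ^ p) / p := fun r hr => by
    have := one_sub_rpow_div_le (p := p) (q := 4) (by norm_num) (by linarith) hr
    rw [show r ^ (4 : ℝ) = r ^ 4 by norm_cast] at this
    linarith
  have m1 := mul_nonneg (hlog s hs) hP₁
  have m2 := mul_nonneg (hlog t ht) hP₂
  have m3 := mul_nonneg (h2 s hs) hA
  have m4 := mul_nonneg (h2 t ht) hB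
  have haD : 0 ≤ a * D := by positivity
  have m5 := mul_nonneg (h2 s hs) haD
  have m6 := mul_nonneg (h2 t ht) haD
  have m7 := mul_nonneg (sq_nonneg (s - t)) haD
  have hα : 0 ≤ g₁ + D := by positivity
  have hβ : 0 ≤ g₂ + D := by positivity
  have hbg : 0 ≤ b * (g₁ + g₂ + 2 * D) := by positivity
  have m8 := mul_nonneg (h4 s hs) (mul_nonneg hbg hα)
  have m9 := mul_nonneg (h4 t ht) (mul_nonneg hbg hβ)
  -- `2st ≤ s² + t²` followed by Cauchy–Schwarz with weights `g₁ + D`, `g₂ + D` decouples the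
  -- Kirchhoff square into separate quartics.
  have q1 : (s ^ 2 * g₁ + t ^ 2 * g₂ + 2 * s * t * D) ^ 2
      ≤ (s ^ 2 * (g₁ + D) + t ^ 2 * (g₂ + D)) ^ 2 := by
    refine pow_le_pow_left₀ (by positivity) ?_ 2
    linear_combination mul_nonneg (sq_nonneg (s - t)) hD
  have q2 : (s ^ 2 * (g₁ + D) + t ^ 2 * (g₂ + D)) ^ 2
      ≤ (g₁ + g₂ + 2 * D) * (s ^ 4 * (g₁ + D) + t ^ 4 * (g₂ + D)) := by
    linear_combination mul_nonneg (mul_nonneg hα hβ) (sq_nonneg (s ^ 2 - t ^ 2))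
  have m10 := mul_nonneg (show 0 ≤ b / 4 by positivity) (sub_nonneg.2 (q1.trans q2))
  rw [← sub_nonneg]
  have : fib a b p A B D g₁ g₂ P₁ P₂ L₁ L₂ 1 1 - fib a b p A B D g₁ g₂ P₁ P₂ L₁ L₂ s t
    = (2 / p ^ 2 * (1 - s ^ p) + 1 / p * (s ^ p * Real.log (s ^ 2))) * P₁
    + (2 / p ^ 2 * (1 - t ^ p) + 1 / p * (t ^ p * Real.log (t ^ 2))) * P₂
    + ((1 - s ^ 2) / 2 - (1 - s ^ p) / p) * A + ((1 - t ^ 2) / 2 - (1 - t ^ p) / p) * B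
    + ((1 - s ^ 2) / 2 - (1 - s ^ p) / p) * (a * D) + ((1 - t ^ 2) / 2 - (1 - t ^ p) / p) * (a * D)
    + 1 / 2 * ((s - t) ^ 2 * (a * D))
    + ((1 - s ^ 4) / 4 - (1 - s ^ p) / p) * (b * (g₁ + g₂ + 2 * D) * (g₁ + D))
    + ((1 - t ^ 4) / 4 - (1 - t ^ p) / p) * (b * (g₁ + g₂ + 2 * D) * (g₂ + D))
    + b / 4 * ((g₁ + g₂ + 2 * D) * (s ^ 4 * (g₁ + D) + t ^ 4 * (g₂ + D))
        - (s ^ 2 * g₁ + t ^ 2 * g₂ + 2 * s * t * D) ^ 2) := by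
    rw [e₁, e₂]
    unfold fib
    simp only [Real.one_rpow, one_pow, Real.log_one]
    ring
  rw [this]
  linarith

/-- Beyond `s = 1` all powers are at most `s ^ p`, and the logarithm beats their coefficients. The
bound `C` precedes `K`, so that two such profiles can each be driven below minus the other's bound.
-/
theorem exists_bound_of_log {p c₂ c₄ c₅ c₆ : ℝ} (hp : 4 ≤ p) (h₂ : 0 ≤ c₂) (h₄ : 0 ≤ c₄)
    (h₆ : 0 < c₆) :
    ∃ C : ℝ, 0 ≤ C ∧ ∀ K : ℝ, 0 ≤ K → ∃ R : ℝ, 1 ≤ R ∧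
      (∀ s, 0 ≤ s → c₂ * s ^ 2 + c₄ * s ^ 4 + c₅ * s ^ p - c₆ * (s ^ p * Real.log (s ^ 2)) ≤ C) ∧
      ∀ s, R ≤ s → c₂ * s ^ 2 + c₄ * s ^ 4 + c₅ * s ^ p - c₆ * (s ^ p * Real.log (s ^ 2)) ≤ -K := by
  set F : ℝ → ℝ := fun s =>
    c₂ * s ^ 2 + c₄ * s ^ 4 + c₅ * |s| ^ p - c₆ * (|s| ^ p * Real.log (s ^ 2)) with hF
  have hFc : Continuous F := by
    have h1 := continuous_rpow_mul_log (p := p) (by linarith)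
    have h2 : Continuous fun s : ℝ => |s| ^ p :=
      Continuous.rpow_const continuous_abs fun _ => Or.inr (by linarith)
    fun_prop
  have hFe : ∀ s, 0 ≤ s →
      c₂ * s ^ 2 + c₄ * s ^ 4 + c₅ * s ^ p - c₆ * (s ^ p * Real.log (s ^ 2)) = F s := fun s hs => by
    simp [hF, abs_of_nonneg hs]
  have hdec : ∀ K : ℝ, 0 ≤ K → ∃ R : ℝ, 1 ≤ R ∧ ∀ s, R ≤ s → F s ≤ -K := by
    intro K hK
    refine ⟨Real.exp ((c₂ + c₄ + |c₅| + K) / c₆), Real.one_le_exp (by positivity), fun s hs => ?_⟩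
    have hs1 : 1 ≤ s := (Real.one_le_exp (by positivity)).trans hs
    have hs0 : 0 < s := by linarith
    have hlog : (c₂ + c₄ + |c₅| + K) / c₆ ≤ Real.log s := (Real.le_log_iff_exp_le hs0).2 hs
    rw [div_le_iff₀ h₆] at hlog
    have hlog0 : 0 ≤ Real.log s := Real.log_nonneg hs1
    have e : Real.log (s ^ 2) = 2 * Real.log s := by rw [Real.log_pow]; norm_num
    have hp1 : 1 ≤ s ^ p := Real.one_le_rpow hs1 (by linarith)
    have hp2 : s ^ 2 ≤ s ^ p := by
      rw [← Real.rpow_two]; exact Real.rpow_le_rpow_of_exponent_le hs1 (by linarith)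
    have hp4 : s ^ 4 ≤ s ^ p := by
      rw [show s ^ 4 = s ^ (4 : ℝ) by norm_cast]
      exact Real.rpow_le_rpow_of_exponent_le hs1 (by linarith)
    rw [← hFe s hs0.le, e]
    have n1 := mul_le_mul_of_nonneg_left hp2 h₂
    have n2 := mul_le_mul_of_nonneg_left hp4 h₄
    have n3 := mul_le_mul_of_nonneg_right (le_abs_self c₅) (by linarith : 0 ≤ s ^ p)
    have n4 := mul_le_mul_of_nonneg_right hlog (by linarith : 0 ≤ s ^ p)
    have n5 := mul_le_mul_of_nonneg_left hp1 hK
    have n6 := mul_nonneg (mul_nonneg h₆.le hlog0) (by linarith : 0 ≤ s ^ p)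
    nlinarith
  obtain ⟨R₀, hR₀, hR₀'⟩ := hdec 0 le_rfl
  obtain ⟨C, hC⟩ := (isCompact_Icc (a := (0 : ℝ)) (b := R₀)).bddAbove_image hFc.continuousOn
  have hCs : ∀ s, 0 ≤ s → F s ≤ max C 0 := fun s hs => by
    rcases le_total s R₀ with h | h
    · exact (hC ⟨s, ⟨hs, h⟩, rfl⟩).trans (le_max_left _ _)
    · exact (hR₀' s h).trans (by simp)
  refine ⟨max C 0, le_max_right _ _, fun K hK => ?_⟩
  obtain ⟨R, hR, hR'⟩ := hdec K hK
  refine ⟨R, hR, fun s hs => (hFe s hs).trans_le (hCs s hs), fun s hs => ?_⟩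
  rw [hFe s (by linarith)]
  exact hR' s hs

/-- Near the axis the quadratic gain `s ^ 2 * A` dominates the `s ^ p` terms, and the interaction
with `t` only helps. So no maximum sits at `s = 0`. -/
theorem fib_zero_lt {a b p A B D g₁ g₂ P₁ P₂ L₁ L₂ t : ℝ} (ha : 0 ≤ a) (hb : 0 ≤ b)
    (hp : 4 ≤ p) (hA : 0 < A) (hD : 0 ≤ D) (hg₁ : 0 ≤ g₁) (hg₂ : 0 ≤ g₂)
    (hP₁ : 0 ≤ P₁) (ht : 0 ≤ t) : ∃ s, 0 < s ∧ s < 1 ∧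
    fib a b p A B D g₁ g₂ P₁ P₂ L₁ L₂ 0 t < fib a b p A B D g₁ g₂ P₁ P₂ L₁ L₂ s t := by
  have hp0 : 0 < p := by linarith
  -- Small enough that `s < 1` and `s * |L₁| < A`.
  set s := A / (A + |L₁| + 1) with hs
  have hden : 0 < A + |L₁| + 1 := by positivity
  have hs0 : 0 < s := by positivity
  have hs1 : s < 1 := by rw [hs, div_lt_one hden]; linarith [abs_nonneg L₁]
  refine ⟨s, hs0, hs1, ?_⟩
  have hsL : s * |L₁| < A := by
    rw [hs, div_mul_eq_mul_div, div_lt_iff₀ hden]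
    nlinarith [abs_nonneg L₁]
  have hsp : s ^ p ≤ s ^ 3 := by
    rw [show s ^ 3 = s ^ (3 : ℝ) by norm_cast]
    exact Real.rpow_le_rpow_of_exponent_ge hs0 hs1.le (by linarith)
  have hsp0 : 0 ≤ s ^ p := Real.rpow_nonneg hs0.le p
  have hlog : Real.log (s ^ 2) ≤ 0 := Real.log_nonpos (by positivity) (by nlinarith)
  have k1 : s ^ p * L₁ ≤ s ^ 2 * (s * |L₁|) := by
    calc s ^ p * L₁ ≤ s ^ p * |L₁| := by gcongr; exact le_abs_self _
      _ ≤ s ^ 3 * |L₁| := by gcongr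
      _ = _ := by ring
  have k2 : s ^ 2 * (s * |L₁|) < s ^ 2 * A := by gcongr
  have k3 : s ^ p * (Real.log (s ^ 2) * P₁) ≤ 0 :=
    mul_nonpos_of_nonneg_of_nonpos hsp0 (mul_nonpos_of_nonpos_of_nonneg hlog hP₁)
  have k4 : (t ^ 2 * g₂) ^ 2 ≤ (s ^ 2 * g₁ + t ^ 2 * g₂ + 2 * s * t * D) ^ 2 := by
    refine pow_le_pow_left₀ (by positivity) ?_ 2
    have : 0 ≤ s ^ 2 * g₁ := by positivity
    have : 0 ≤ 2 * s * t * D := by positivity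
    linarith
  have k5 := mul_le_mul_of_nonneg_left k4 (show 0 ≤ b / 4 by positivity)
  have k6 : 0 ≤ 2 / p ^ 2 * (s ^ p * P₁) := by positivity
  have k7 : 0 ≤ s * t * (a * D) := by positivity
  have k8 : 1 / p * (s ^ p * (L₁ + Real.log (s ^ 2) * P₁)) < 1 / 2 * (s ^ 2 * A) := by
    have h1 : s ^ p * (L₁ + Real.log (s ^ 2) * P₁) < s ^ 2 * A := by linarith
    have h2 : (1 : ℝ) / p ≤ 1 / 2 := by gcongr; linarith
    calc _ < 1 / p * (s ^ 2 * A) := by gcongr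
      _ ≤ _ := by gcongr
  unfold fib
  rw [Real.zero_rpow hp0.ne']
  nlinarith

theorem exists_critical_fib {a b p A B D g₁ g₂ P₁ P₂ L₁ L₂ : ℝ} (ha : 0 ≤ a) (hb : 0 ≤ b)
    (hp : 4 ≤ p) (hA : 0 < A) (hB : 0 < B) (hD : 0 ≤ D) (hg₁ : 0 ≤ g₁) (hg₂ : 0 ≤ g₂)
    (hP₁ : 0 < P₁) (hP₂ : 0 < P₂) : ∃ s t, 0 < s ∧ 0 < t ∧
      fibDeriv a b p A D g₁ g₂ P₁ L₁ s t = 0 ∧ fibDeriv a b p B D g₂ g₁ P₂ L₂ t s = 0 := by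
  have hp0 : 0 < p := by linarith
  set f : ℝ → ℝ → ℝ := fib a b p A B D g₁ g₂ P₁ P₂ L₁ L₂ with hf
  have hup : ∀ s t, 0 ≤ s → 0 ≤ t → f s t ≤
      ((A + a * D) / 2 * s ^ 2 + b / 4 * ((g₁ + g₂ + 2 * D) * (g₁ + D)) * s ^ 4
        + (2 / p ^ 2 * P₁ - 1 / p * L₁) * s ^ p - P₁ / p * (s ^ p * Real.log (s ^ 2)))
      + ((B + a * D) / 2 * t ^ 2 + b / 4 * ((g₁ + g₂ + 2 * D) * (g₂ + D)) * t ^ 4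
        + (2 / p ^ 2 * P₂ - 1 / p * L₂) * t ^ p - P₂ / p * (t ^ p * Real.log (t ^ 2))) := by
    intro s t hs ht
    have hα : 0 ≤ g₁ + D := by positivity
    have hβ : 0 ≤ g₂ + D := by positivity
    have q1 : (s ^ 2 * g₁ + t ^ 2 * g₂ + 2 * s * t * D) ^ 2
        ≤ (s ^ 2 * (g₁ + D) + t ^ 2 * (g₂ + D)) ^ 2 := by
      refine pow_le_pow_left₀ (by positivity) ?_ 2
      linear_combination mul_nonneg (sq_nonneg (s - t)) hD
    have q2 : (s ^ 2 * (g₁ + D) + t ^ 2 * (g₂ + D)) ^ 2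
        ≤ (g₁ + g₂ + 2 * D) * (s ^ 4 * (g₁ + D) + t ^ 4 * (g₂ + D)) := by
      linear_combination mul_nonneg (mul_nonneg hα hβ) (sq_nonneg (s ^ 2 - t ^ 2))
    have m10 := mul_nonneg (show 0 ≤ b / 4 by positivity) (sub_nonneg.2 (q1.trans q2))
    have m7 := mul_nonneg (sq_nonneg (s - t)) (mul_nonneg ha hD)
    rw [← sub_nonneg]
    refine (add_nonneg m10 (mul_nonneg (show (0 : ℝ) ≤ 1 / 2 by norm_num) m7)).trans_eq ?_
    rw [hf]; unfold fib; ring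
  obtain ⟨C₁, hC₁, H₁⟩ := exists_bound_of_log (p := p) (c₂ := (A + a * D) / 2)
    (c₄ := b / 4 * ((g₁ + g₂ + 2 * D) * (g₁ + D))) (c₅ := 2 / p ^ 2 * P₁ - 1 / p * L₁)
    (c₆ := P₁ / p) hp (by positivity) (by positivity) (by positivity)
  obtain ⟨C₂, hC₂, H₂⟩ := exists_bound_of_log (p := p) (c₂ := (B + a * D) / 2)
    (c₄ := b / 4 * ((g₁ + g₂ + 2 * D) * (g₂ + D))) (c₅ := 2 / p ^ 2 * P₂ - 1 / p * L₂)
    (c₆ := P₂ / p) hp (by positivity) (by positivity) (by positivity)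
  -- Each radius is chosen against the other variable's bound, so outside the box `f ≤ 0 = f 0 0`
  -- and the maximum over the box is global.
  obtain ⟨R₁, hR₁, hb₁, hd₁⟩ := H₁ C₂ hC₂
  obtain ⟨R₂, hR₂, hb₂, hd₂⟩ := H₂ C₁ hC₁
  have hf0 : f 0 0 = 0 := by simp [hf, fib, hp0.ne']
  have hcont : ContinuousOn (fun z : ℝ × ℝ => f z.1 z.2) (Set.Icc 0 R₁ ×ˢ Set.Icc 0 R₂) := by
    have c1 := continuous_rpow_mul_log hp0
    have c2 : Continuous fun s : ℝ => |s| ^ p :=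
      Continuous.rpow_const continuous_abs fun _ => Or.inr hp0.le
    -- With `|z|` in the powers and the product with the logarithm kept together, the formula is
    -- continuous on the whole plane and agrees with `f` on the quadrant.
    have c3 : Continuous fun z : ℝ × ℝ =>
        1 / 2 * (z.1 ^ 2 * A + z.2 ^ 2 * B + 2 * z.1 * z.2 * (a * D))
        + b / 4 * (z.1 ^ 2 * g₁ + z.2 ^ 2 * g₂ + 2 * z.1 * z.2 * D) ^ 2
        + 2 / p ^ 2 * (|z.1| ^ p * P₁ + |z.2| ^ p * P₂)
        - 1 / p * ((|z.1| ^ p * L₁ + |z.1| ^ p * Real.log (z.1 ^ 2) * P₁)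
          + (|z.2| ^ p * L₂ + |z.2| ^ p * Real.log (z.2 ^ 2) * P₂)) := by
      have d1 := c1.comp (continuous_fst (X := ℝ) (Y := ℝ))
      have d2 := c1.comp (continuous_snd (X := ℝ) (Y := ℝ))
      have d3 := c2.comp (continuous_fst (X := ℝ) (Y := ℝ))
      have d4 := c2.comp (continuous_snd (X := ℝ) (Y := ℝ))
      simp only [Function.comp_def] at d1 d2 d3 d4
      fun_prop
    refine c3.continuousOn.congr fun z hz => ?_
    simp only [hf, fib, abs_of_nonneg hz.1.1, abs_of_nonneg hz.2.1]
    ring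
  obtain ⟨⟨s, t⟩, ⟨⟨hs0, hsR⟩, ⟨ht0, htR⟩⟩, hmax⟩ := (isCompact_Icc.prod isCompact_Icc).exists_isMaxOn
    (⟨(0, 0), ⟨⟨le_rfl, by linarith⟩, ⟨le_rfl, by linarith⟩⟩⟩ :
      (Set.Icc 0 R₁ ×ˢ Set.Icc 0 R₂ : Set (ℝ × ℝ)).Nonempty) hcont
  simp only at hs0 hsR ht0 htR
  have hmax' : ∀ s' t', 0 ≤ s' → 0 ≤ t' → f s' t' ≤ f s t := by
    intro s' t' hs' ht'
    have h00 : 0 ≤ f s t := hf0 ▸ hmax (a := (0, 0)) ⟨⟨le_rfl, by linarith⟩, ⟨le_rfl, by linarith⟩⟩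
    by_cases h1 : s' ≤ R₁
    · by_cases h2 : t' ≤ R₂
      · exact hmax (a := (s', t')) ⟨⟨hs', h1⟩, ⟨ht', h2⟩⟩
      · have := hup s' t' hs' ht'
        have := hb₁ s' hs'
        have := hd₂ t' (by linarith)
        linarith
    · have := hup s' t' hs' ht'
      have := hd₁ s' (by linarith)
      have := hb₂ t' ht'
      linarith
  have hs : 0 < s := by
    refine hs0.lt_of_ne fun h0 => ?_
    subst h0
    obtain ⟨s', h1, -, h3⟩ := fib_zero_lt (B := B) (P₂ := P₂) (L₁ := L₁) (L₂ := L₂) ha hb hp hA hD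
      hg₁ hg₂ hP₁.le ht0
    exact absurd (hmax' s' t h1.le ht0) (not_le.2 h3)
  have ht : 0 < t := by
    refine ht0.lt_of_ne fun h0 => ?_
    subst h0
    obtain ⟨t', h1, -, h3⟩ := fib_zero_lt (B := A) (P₂ := P₁) (L₁ := L₂) (L₂ := L₁) ha hb hp hB hD
      hg₂ hg₁ hP₂.le hs0
    rw [fib_comm, fib_comm _ _ _ B] at h3
    exact absurd (hmax' s t' hs0 h1.le) (not_le.2 h3)
  refine ⟨s, t, hs, ht, ?_, ?_⟩
  · refine IsLocalMax.hasDerivAt_eq_zero (f := fun s => f s t) ?_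
      (hasDerivAt_fib a b p A B D g₁ g₂ P₁ P₂ L₁ L₂ t hp0 hs)
    filter_upwards [lt_mem_nhds hs] with s' hs'
    exact hmax' s' t hs'.le ht.le
  · refine IsLocalMax.hasDerivAt_eq_zero (f := fun t => f s t) ?_ (f' := _) (a := t) ?_
    · filter_upwards [lt_mem_nhds ht] with t' ht'
      exact hmax' s t' hs.le ht'.le
    · have := hasDerivAt_fib a b p B A D g₂ g₁ P₂ P₁ L₂ L₁ s hp0 ht
      simpa only [hf, fib_comm _ _ _ A] using this

/-! ### Positive and negative parts, and expansion of the energy -/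

/-- The Dirichlet form `∫ ∇u ∇v`. -/
noncomputable def dirichlet (u v : V → ℝ) : ℝ := ∑' x, gradForm u v x

/-- The quadratic form `∫ a|∇u|² + (λ h + 1) u²`. -/
noncomputable def quadForm (a : ℝ) (h : V → ℝ) (lam : ℝ) (u : V → ℝ) : ℝ :=
  a * dirichlet u u + ∑' x, (lam * h x + 1) * u x ^ 2

/-- The integral `∫ |u|^p`. -/
noncomputable def powSum (p : ℝ) (u : V → ℝ) : ℝ := ∑' x, |u x| ^ p

/-- The integral `∫ |u|^p log u²`. -/
noncomputable def logSum (p : ℝ) (u : V → ℝ) : ℝ := ∑' x, |u x| ^ p * Real.log (u x ^ 2)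

theorem uPlus_add_uMinus (u : V → ℝ) (x : V) : uPlus u x + uMinus u x = u x := by
  simp [uPlus, uMinus, max_add_min]

theorem uPlus_mul_uMinus (u : V → ℝ) (x : V) : uPlus u x * uMinus u x = 0 := by
  rcases le_total (u x) 0 with h | h <;> simp [uPlus, uMinus, h]

theorem abs_uPlus_le (u : V → ℝ) (x : V) : |uPlus u x| ≤ |u x| := by
  rcases le_total (u x) 0 with h | h <;> simp [uPlus, h]

theorem abs_uMinus_le (u : V → ℝ) (x : V) : |uMinus u x| ≤ |u x| := by
  rcases le_total (u x) 0 with h | h <;> simp [uMinus, h]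

theorem uPlus_ne_zero {u : V → ℝ} : uPlus u ≠ 0 ↔ ∃ x, 0 < u x := by
  rw [Function.ne_iff]
  simp [uPlus]

theorem uMinus_ne_zero {u : V → ℝ} : uMinus u ≠ 0 ↔ ∃ x, u x < 0 := by
  rw [Function.ne_iff]
  simp [uMinus]

/-- The function `s u⁺ + t u⁻`. -/
def comb (s t : ℝ) (u : V → ℝ) (x : V) : ℝ := s * uPlus u x + t * uMinus u x

theorem comb_one_one (u : V → ℝ) : comb 1 1 u = u := by
  funext x; simp [comb, uPlus_add_uMinus]

theorem uPlus_comb {s t : ℝ} (hs : 0 ≤ s) (ht : 0 ≤ t) (u : V → ℝ) :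
    uPlus (comb s t u) = fun x => s * uPlus u x := by
  funext x
  rcases le_total (u x) 0 with h | h
  · simp [comb, uPlus, uMinus, h, mul_nonpos_of_nonneg_of_nonpos ht h]
  · simp [comb, uPlus, uMinus, h, mul_nonneg hs h]

theorem uMinus_comb {s t : ℝ} (hs : 0 ≤ s) (ht : 0 ≤ t) (u : V → ℝ) :
    uMinus (comb s t u) = fun x => t * uMinus u x := by
  funext x
  rcases le_total (u x) 0 with h | h
  · simp [comb, uPlus, uMinus, h, mul_nonpos_of_nonneg_of_nonpos ht h]
  · simp [comb, uPlus, uMinus, h, mul_nonneg hs h]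

theorem abs_comb_le {s t : ℝ} (hs : 0 ≤ s) (ht : 0 ≤ t) (u : V → ℝ) (x : V) :
    |comb s t u x| ≤ (s + t) * |u x| := by
  refine (abs_add_le _ _).trans ?_
  rw [abs_mul, abs_mul, abs_of_nonneg hs, abs_of_nonneg ht, add_mul]
  exact add_le_add (mul_le_mul_of_nonneg_left (abs_uPlus_le u x) hs)
    (mul_le_mul_of_nonneg_left (abs_uMinus_le u x) ht)

theorem gradForm_comm (u v : V → ℝ) (x : V) : gradForm u v x = gradForm v u x := by
  simp only [gradForm, mul_comm]

theorem dirichlet_comm (u v : V → ℝ) : dirichlet u v = dirichlet v u :=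
  tsum_congr fun x => gradForm_comm u v x

theorem dirichlet_self_nonneg (u : V → ℝ) : 0 ≤ dirichlet u u :=
  tsum_nonneg (gradForm_self_nonneg u)

/-- Both parts are nondecreasing functions of `u`, so along each edge their increments have the same
sign. -/
theorem dirichlet_uPlus_uMinus_nonneg (u : V → ℝ) : 0 ≤ dirichlet (uPlus u) (uMinus u) := by
  refine tsum_nonneg fun x => mul_nonneg (by norm_num) (Finset.sum_nonneg fun y _ => ?_)
  rcases le_total (u y) (u x) with h | h
  · exact mul_nonneg_of_nonpos_of_nonpos (sub_nonpos.2 (max_le_max_right 0 h))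
      (sub_nonpos.2 (min_le_min_right 0 h))
  · exact mul_nonneg (sub_nonneg.2 (max_le_max_right 0 h)) (sub_nonneg.2 (min_le_min_right 0 h))

section expansions

variable {a b p lam s t : ℝ} {h : V → ℝ} {v w : V → ℝ}

theorem gradForm_comb_left (u : V → ℝ) (x : V) :
    gradForm (fun x => s * v x + t * w x) u x = s * gradForm v u x + t * gradForm w u x := by
  simp only [gradForm, Finset.mul_sum, ← Finset.sum_add_distrib]
  exact Finset.sum_congr rfl fun y _ => by ring

theorem gradForm_mul_right (u : V → ℝ) (x : V) :
    gradForm u (fun x => s * v x) x = s * gradForm u v x := by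
  simp only [gradForm, Finset.mul_sum]
  exact Finset.sum_congr rfl fun y _ => by ring

theorem dirichlet_comb_left {u : V → ℝ} (hv : Summable fun x => v x ^ 2)
    (hw : Summable fun x => w x ^ 2) (hu : Summable fun x => u x ^ 2) :
    dirichlet (fun x => s * v x + t * w x) u = s * dirichlet v u + t * dirichlet w u := by
  simp only [dirichlet, gradForm_comb_left]
  rw [((summable_gradForm hv hu).mul_left s).tsum_add ((summable_gradForm hw hu).mul_left t),
    tsum_mul_left, tsum_mul_left]

theorem summable_comb_sq (hv : Summable fun x => v x ^ 2) (hw : Summable fun x => w x ^ 2) :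
    Summable fun x => (s * v x + t * w x) ^ 2 :=
  Summable.of_nonneg_of_le (fun x => sq_nonneg _)
    (fun x => by nlinarith [sq_nonneg (s * v x - t * w x)])
    ((hv.mul_left (2 * s ^ 2)).add (hw.mul_left (2 * t ^ 2)))

theorem dirichlet_comb (hv : Summable fun x => v x ^ 2) (hw : Summable fun x => w x ^ 2) :
    dirichlet (fun x => s * v x + t * w x) (fun x => s * v x + t * w x)
      = s ^ 2 * dirichlet v v + t ^ 2 * dirichlet w w + 2 * s * t * dirichlet v w := by
  have h1 := summable_comb_sq (s := s) (t := t) hv hw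
  rw [dirichlet_comb_left hv hw h1, dirichlet_comm v, dirichlet_comm w,
    dirichlet_comb_left hv hw hv, dirichlet_comb_left hv hw hw, dirichlet_comm w v]
  ring

theorem HLam.summable_sq {u : V → ℝ} (hu : u ∈ HLam h lam) : Summable fun x => u x ^ 2 :=
  mem_H1.1 hu.1

theorem HLam.summable_weight {u : V → ℝ} (hu : u ∈ HLam h lam) :
    Summable fun x => (lam * h x + 1) * u x ^ 2 :=
  (hu.2.add (mem_H1.1 hu.1)).congr fun _ => (add_one_mul _ _).symm

theorem HLam.of_abs_le (hlam : 0 ≤ lam) (hh : ∀ x, 0 ≤ h x) {u : V → ℝ} (hu : u ∈ HLam h lam)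
    (C : ℝ) (hle : ∀ x, |v x| ≤ C * |u x|) : v ∈ HLam h lam := by
  have hsq : ∀ x, v x ^ 2 ≤ C ^ 2 * u x ^ 2 := fun x => by
    rw [← sq_abs, ← sq_abs (u x), ← mul_pow]
    exact pow_le_pow_left₀ (abs_nonneg _) (hle x) 2
  refine ⟨mem_H1.2 (Summable.of_nonneg_of_le (fun x => sq_nonneg _) hsq
    ((HLam.summable_sq hu).mul_left _)), ?_⟩
  refine Summable.of_nonneg_of_le (fun x => mul_nonneg (mul_nonneg hlam (hh x)) (sq_nonneg _))
    (fun x => ?_) (hu.2.mul_left (C ^ 2))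
  have := mul_le_mul_of_nonneg_left (hsq x) (mul_nonneg hlam (hh x))
  linarith

theorem J_eq {u : V → ℝ} (hu : u ∈ HLam h lam) :
    J a b p h lam u = 1 / 2 * quadForm a h lam u + b / 4 * dirichlet u u ^ 2
      + 2 / p ^ 2 * powSum p u - 1 / p * logSum p u := by
  unfold J quadForm dirichlet
  rw [((summable_gradForm (HLam.summable_sq hu) (HLam.summable_sq hu)).mul_left a).tsum_add (HLam.summable_weight hu),
    tsum_mul_left]
  rfl

theorem log_comb_aux (hp : 0 < p) (hs : 0 ≤ s) (y : ℝ) :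
    |s * y| ^ p * Real.log ((s * y) ^ 2)
      = s ^ p * (|y| ^ p * Real.log (y ^ 2)) + s ^ p * Real.log (s ^ 2) * |y| ^ p := by
  rcases hs.eq_or_lt with rfl | hs
  · simp [hp.ne']
  rcases eq_or_ne y 0 with rfl | hy
  · simp [hp.ne']
  rw [abs_mul, abs_of_pos hs, Real.mul_rpow hs.le (abs_nonneg _), mul_pow,
    Real.log_mul (by positivity) (by positivity)]
  ring

theorem J_comb (hp : 4 ≤ p) (hv : v ∈ HLam h lam) (hw : w ∈ HLam h lam)
    (hvw : ∀ x, v x * w x = 0) (hs : 0 ≤ s) (ht : 0 ≤ t)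
    (hc : (fun x => s * v x + t * w x) ∈ HLam h lam) :
    J a b p h lam (fun x => s * v x + t * w x)
      = fib a b p (quadForm a h lam v) (quadForm a h lam w) (dirichlet v w) (dirichlet v v)
        (dirichlet w w) (powSum p v) (powSum p w) (logSum p v) (logSum p w) s t := by
  have hp0 : 0 < p := by linarith
  rw [J_eq hc]
  have e1 : ∑' x, (lam * h x + 1) * (s * v x + t * w x) ^ 2
      = s ^ 2 * ∑' x, (lam * h x + 1) * v x ^ 2 + t ^ 2 * ∑' x, (lam * h x + 1) * w x ^ 2 := by
    rw [← tsum_mul_left, ← tsum_mul_left,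
      ← ((HLam.summable_weight hv).mul_left _).tsum_add ((HLam.summable_weight hw).mul_left _)]
    refine tsum_congr fun x => ?_
    linear_combination (lam * h x + 1) * 2 * s * t * hvw x
  have e2 : powSum p (fun x => s * v x + t * w x) = s ^ p * powSum p v + t ^ p * powSum p w := by
    unfold powSum
    rw [← tsum_mul_left, ← tsum_mul_left,
      ← ((summable_rpow (by linarith) (HLam.summable_sq hv)).mul_left _).tsum_add
        ((summable_rpow (by linarith) (HLam.summable_sq hw)).mul_left _)]
    refine tsum_congr fun x => ?_
    rcases mul_eq_zero.1 (hvw x) with h0 | h0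
    · simp [h0, abs_mul, Real.mul_rpow, abs_of_nonneg ht, ht, hp0.ne']
    · simp [h0, abs_mul, Real.mul_rpow, abs_of_nonneg hs, hs, hp0.ne']
  have e3 : logSum p (fun x => s * v x + t * w x)
      = s ^ p * (logSum p v + Real.log (s ^ 2) * powSum p v)
        + t ^ p * (logSum p w + Real.log (t ^ 2) * powSum p w) := by
    have k : ∀ {r : ℝ} {z : V → ℝ}, 0 ≤ r → (Summable fun x => z x ^ 2) →
        HasSum (fun x => |r * z x| ^ p * Real.log ((r * z x) ^ 2))
          (r ^ p * (logSum p z + Real.log (r ^ 2) * powSum p z)) := by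
      intro r z hr hz
      simp only [log_comb_aux hp0 hr, mul_add, ← mul_assoc (r ^ p) (Real.log (r ^ 2))]
      exact ((summable_rpow_mul_log (p := p) (by linarith) hz).hasSum.mul_left (r ^ p)).add
        ((summable_rpow (p := p) (by linarith) hz).hasSum.mul_left (r ^ p * Real.log (r ^ 2)))
    refine (((k hs (HLam.summable_sq hv)).add (k ht (HLam.summable_sq hw))).tsum_eq ▸ tsum_congr fun x => ?_)
    rcases mul_eq_zero.1 (hvw x) with h0 | h0 <;> simp [h0, hp0.ne']
  rw [e2, e3]
  unfold quadForm fib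
  rw [e1, dirichlet_comb (HLam.summable_sq hv) (HLam.summable_sq hw)]
  ring

/-- Identifies the Nehari constraints with the critical point equations of `fib`. -/
theorem dJ_comb (hp : 4 ≤ p) (hv : v ∈ HLam h lam) (hw : w ∈ HLam h lam)
    (hvw : ∀ x, v x * w x = 0) (hs : 0 < s) :
    dJ a b p h lam (fun x => s * v x + t * w x) (fun x => s * v x)
      = s * fibDeriv a b p (quadForm a h lam v) (dirichlet v w) (dirichlet v v)
        (dirichlet w w) (powSum p v) (logSum p v) s t := by
  have hp0 : 0 < p := by linarith
  have hv2 := (HLam.summable_sq hv)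
  have hw2 := (HLam.summable_sq hw)
  have d1 : ∑' x, gradForm (fun x => s * v x + t * w x) (fun x => s * v x) x
      = s * (s * dirichlet v v + t * dirichlet v w) := by
    simp only [gradForm_mul_right]
    rw [tsum_mul_left, dirichlet_comm v w]
    congr 1
    exact dirichlet_comb_left hv2 hw2 hv2
  have e1 : ∑' x, (a * gradForm (fun x => s * v x + t * w x) (fun x => s * v x) x
        + (lam * h x + 1) * (s * v x + t * w x) * (s * v x))
      = a * (s * (s * dirichlet v v + t * dirichlet v w))
        + s ^ 2 * ∑' x, (lam * h x + 1) * v x ^ 2 := by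
    have hsm : Summable fun x => gradForm (fun x => s * v x + t * w x) (fun x => s * v x) x := by
      refine summable_gradForm (summable_comb_sq hv2 hw2) ((hv2.mul_left (s ^ 2)).congr fun x => ?_)
      ring
    rw [← d1, ← tsum_mul_left, ← tsum_mul_left,
      ← (hsm.mul_left a).tsum_add ((HLam.summable_weight hv).mul_left _)]
    refine tsum_congr fun x => ?_
    linear_combination (lam * h x + 1) * s * t * hvw x
  have e2 : ∑' x, |s * v x + t * w x| ^ (p - 2) * (s * v x + t * w x) * (s * v x)
        * Real.log ((s * v x + t * w x) ^ 2)
      = s ^ p * (logSum p v + Real.log (s ^ 2) * powSum p v) := by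
    unfold logSum powSum
    rw [mul_add, ← mul_assoc, ← tsum_mul_left, ← tsum_mul_left,
      ← ((summable_rpow_mul_log (p := p) (by linarith) hv2).mul_left _).tsum_add
        ((summable_rpow (p := p) (by linarith) hv2).mul_left _)]
    refine tsum_congr fun x => ?_
    rw [← log_comb_aux hp0 hs.le]
    rcases eq_or_ne (v x) 0 with h0 | h0
    · simp [h0, hp0.ne']
    · rw [(mul_eq_zero.1 (hvw x)).resolve_left h0, mul_zero, add_zero]
      have hpos : 0 < |s * v x| := abs_pos.2 (mul_ne_zero hs.ne' h0)
      have : |s * v x| ^ p = |s * v x| ^ (p - 2) * (s * v x) ^ 2 := by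
        rw [← sq_abs (s * v x), ← Real.rpow_two, ← Real.rpow_add hpos, sub_add_cancel]
      rw [this]; ring
  have hsp : s ^ p = s * s ^ (p - 1) := by
    rw [mul_comm, ← Real.rpow_add_one hs.ne', sub_add_cancel]
  unfold dJ
  rw [e1, e2, d1, hsp, show ∑' x, gradForm (fun x => s * v x + t * w x)
    (fun x => s * v x + t * w x) x = _ from dirichlet_comb hv2 hw2]
  unfold fibDeriv quadForm
  ring

end expansions

/-! ### The sign-changing Nehari set -/

section nehari

variable {a b p lam s t : ℝ} {h u : V → ℝ}

theorem HLam.uPlus_mem (hlam : 0 ≤ lam) (hh : ∀ x, 0 ≤ h x) (hu : u ∈ HLam h lam) :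
    uPlus u ∈ HLam h lam :=
  HLam.of_abs_le hlam hh hu 1 fun x => by simpa using abs_uPlus_le u x

theorem HLam.uMinus_mem (hlam : 0 ≤ lam) (hh : ∀ x, 0 ≤ h x) (hu : u ∈ HLam h lam) :
    uMinus u ∈ HLam h lam :=
  HLam.of_abs_le hlam hh hu 1 fun x => by simpa using abs_uMinus_le u x

theorem HLam.comb_mem (hlam : 0 ≤ lam) (hh : ∀ x, 0 ≤ h x) (hu : u ∈ HLam h lam)
    (hs : 0 ≤ s) (ht : 0 ≤ t) : comb s t u ∈ HLam h lam :=
  HLam.of_abs_le hlam hh hu _ fun x => abs_comb_le hs ht u x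

theorem J_comb_eq_fib (hp : 4 ≤ p) (hlam : 0 ≤ lam) (hh : ∀ x, 0 ≤ h x) (hu : u ∈ HLam h lam)
    (hs : 0 ≤ s) (ht : 0 ≤ t) :
    J a b p h lam (comb s t u)
      = fib a b p (quadForm a h lam (uPlus u)) (quadForm a h lam (uMinus u))
        (dirichlet (uPlus u) (uMinus u)) (dirichlet (uPlus u) (uPlus u))
        (dirichlet (uMinus u) (uMinus u)) (powSum p (uPlus u)) (powSum p (uMinus u))
        (logSum p (uPlus u)) (logSum p (uMinus u)) s t :=
  J_comb hp (HLam.uPlus_mem hlam hh hu) (HLam.uMinus_mem hlam hh hu) (uPlus_mul_uMinus u) hs ht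
    (HLam.comb_mem hlam hh hu hs ht)

theorem dJ_comb_uPlus (hp : 4 ≤ p) (hlam : 0 ≤ lam) (hh : ∀ x, 0 ≤ h x) (hu : u ∈ HLam h lam)
    (hs : 0 < s) (ht : 0 < t) :
    dJ a b p h lam (comb s t u) (uPlus (comb s t u))
      = s * fibDeriv a b p (quadForm a h lam (uPlus u))
        (dirichlet (uPlus u) (uMinus u)) (dirichlet (uPlus u) (uPlus u))
        (dirichlet (uMinus u) (uMinus u)) (powSum p (uPlus u)) (logSum p (uPlus u)) s t := by
  rw [uPlus_comb hs.le ht.le]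
  exact dJ_comb hp (HLam.uPlus_mem hlam hh hu) (HLam.uMinus_mem hlam hh hu) (uPlus_mul_uMinus u) hs

theorem dJ_comb_uMinus (hp : 4 ≤ p) (hlam : 0 ≤ lam) (hh : ∀ x, 0 ≤ h x) (hu : u ∈ HLam h lam)
    (hs : 0 < s) (ht : 0 < t) :
    dJ a b p h lam (comb s t u) (uMinus (comb s t u))
      = t * fibDeriv a b p (quadForm a h lam (uMinus u))
        (dirichlet (uPlus u) (uMinus u)) (dirichlet (uMinus u) (uMinus u))
        (dirichlet (uPlus u) (uPlus u)) (powSum p (uMinus u)) (logSum p (uMinus u)) t s := by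
  rw [uMinus_comb hs.le ht.le, dirichlet_comm (uPlus u)]
  have := dJ_comb (a := a) (b := b) (t := s) hp (HLam.uMinus_mem hlam hh hu) (HLam.uPlus_mem hlam hh hu)
    (fun x => (mul_comm _ _).trans (uPlus_mul_uMinus u x)) ht
  rw [← this]
  congr 1
  funext x
  exact add_comm _ _

theorem quadForm_nonneg (ha : 0 ≤ a) (hlam : 0 ≤ lam) (hh : ∀ x, 0 ≤ h x) (u : V → ℝ) :
    0 ≤ quadForm a h lam u :=
  add_nonneg (mul_nonneg ha (dirichlet_self_nonneg u)) (tsum_nonneg fun x =>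
    mul_nonneg (add_nonneg (mul_nonneg hlam (hh x)) zero_le_one) (sq_nonneg _))

theorem quadForm_pos (ha : 0 ≤ a) (hlam : 0 ≤ lam) (hh : ∀ x, 0 ≤ h x) (hu : u ∈ HLam h lam)
    (h0 : u ≠ 0) : 0 < quadForm a h lam u := by
  obtain ⟨x, hx⟩ := Function.ne_iff.1 h0
  have hx' : u x ≠ 0 := hx
  have hw : ∀ x, 0 < lam * h x + 1 := fun x => by
    have := mul_nonneg hlam (hh x)
    linarith
  refine add_pos_of_nonneg_of_pos (mul_nonneg ha (dirichlet_self_nonneg u))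
    ((HLam.summable_weight hu).tsum_pos (fun y => mul_nonneg (hw y).le (sq_nonneg _)) x
      (mul_pos (hw x) (by positivity)))

theorem powSum_nonneg (p : ℝ) (u : V → ℝ) : 0 ≤ powSum p u :=
  tsum_nonneg fun _ => Real.rpow_nonneg (abs_nonneg _) _

theorem powSum_pos (hp : 2 ≤ p) (hu : Summable fun x => u x ^ 2) (h0 : u ≠ 0) :
    0 < powSum p u := by
  obtain ⟨x, hx⟩ := Function.ne_iff.1 h0
  exact (summable_rpow hp hu).tsum_pos (fun _ => Real.rpow_nonneg (abs_nonneg _) _) x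
    (Real.rpow_pos_of_pos (abs_pos.2 hx) _)

theorem exists_comb_mem_nehariSC (ha : 0 ≤ a) (hb : 0 ≤ b) (hp : 4 ≤ p) (hlam : 0 ≤ lam)
    (hh : ∀ x, 0 ≤ h x) (hu : u ∈ HLam h lam) (h₁ : uPlus u ≠ 0) (h₂ : uMinus u ≠ 0) :
    ∃ s t, 0 < s ∧ 0 < t ∧ comb s t u ∈ nehariSC a b p h lam := by
  have hv := HLam.uPlus_mem hlam hh hu
  have hw := HLam.uMinus_mem hlam hh hu
  obtain ⟨s, t, hs, ht, e₁, e₂⟩ := exists_critical_fib (L₁ := logSum p (uPlus u))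
    (L₂ := logSum p (uMinus u)) ha hb hp
    (quadForm_pos ha hlam hh hv h₁) (quadForm_pos ha hlam hh hw h₂)
    (dirichlet_uPlus_uMinus_nonneg u) (dirichlet_self_nonneg (uPlus u))
    (dirichlet_self_nonneg (uMinus u)) (powSum_pos (p := p) (by linarith) (HLam.summable_sq hv) h₁)
    (powSum_pos (p := p) (by linarith) (HLam.summable_sq hw) h₂)
  refine ⟨s, t, hs, ht, HLam.comb_mem hlam hh hu hs.le ht.le, ?_, ?_, ?_, ?_⟩
  · rw [uPlus_comb hs.le ht.le]
    obtain ⟨x, hx⟩ := Function.ne_iff.1 h₁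
    exact Function.ne_iff.2 ⟨x, mul_ne_zero hs.ne' hx⟩
  · rw [uMinus_comb hs.le ht.le]
    obtain ⟨x, hx⟩ := Function.ne_iff.1 h₂
    exact Function.ne_iff.2 ⟨x, mul_ne_zero ht.ne' hx⟩
  · rw [dJ_comb_uPlus hp hlam hh hu hs ht, e₁, mul_zero]
  · rw [dJ_comb_uMinus hp hlam hh hu hs ht, e₂, mul_zero]

theorem nehariSC.fibDeriv_uPlus (hp : 4 ≤ p) (hlam : 0 ≤ lam) (hh : ∀ x, 0 ≤ h x)
    (hu : u ∈ nehariSC a b p h lam) :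
    fibDeriv a b p (quadForm a h lam (uPlus u))
        (dirichlet (uPlus u) (uMinus u)) (dirichlet (uPlus u) (uPlus u))
        (dirichlet (uMinus u) (uMinus u)) (powSum p (uPlus u)) (logSum p (uPlus u)) 1 1 = 0 := by
  have := dJ_comb_uPlus (a := a) (b := b) hp hlam hh hu.1 one_pos one_pos
  rw [comb_one_one, hu.2.2.2.1] at this
  linarith

theorem nehariSC.fibDeriv_uMinus (hp : 4 ≤ p) (hlam : 0 ≤ lam) (hh : ∀ x, 0 ≤ h x)
    (hu : u ∈ nehariSC a b p h lam) :
    fibDeriv a b p (quadForm a h lam (uMinus u))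
        (dirichlet (uPlus u) (uMinus u)) (dirichlet (uMinus u) (uMinus u))
        (dirichlet (uPlus u) (uPlus u)) (powSum p (uMinus u)) (logSum p (uMinus u)) 1 1 = 0 := by
  have := dJ_comb_uMinus (a := a) (b := b) hp hlam hh hu.1 one_pos one_pos
  rw [comb_one_one, hu.2.2.2.2] at this
  linarith

theorem nehariSC.J_comb_le (ha : 0 ≤ a) (hb : 0 ≤ b) (hp : 4 ≤ p) (hlam : 0 ≤ lam)
    (hh : ∀ x, 0 ≤ h x) (hu : u ∈ nehariSC a b p h lam) (hs : 0 ≤ s) (ht : 0 ≤ t) :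
    J a b p h lam (comb s t u) ≤ J a b p h lam u := by
  conv_rhs => rw [← comb_one_one u]
  rw [J_comb_eq_fib hp hlam hh hu.1 hs ht, J_comb_eq_fib hp hlam hh hu.1 zero_le_one zero_le_one]
  exact fib_le_fib_one ha hb hp (quadForm_nonneg ha hlam hh _) (quadForm_nonneg ha hlam hh _)
    (dirichlet_uPlus_uMinus_nonneg u) (dirichlet_self_nonneg _) (dirichlet_self_nonneg _)
    (powSum_nonneg _ _) (powSum_nonneg _ _) hs ht (nehariSC.fibDeriv_uPlus hp hlam hh hu)
    (nehariSC.fibDeriv_uMinus hp hlam hh hu)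

/-- Subtracting `1 / p` times both constraints removes the logarithm. What remains is nonnegative,
and `1 / 2 - 1 / p ≥ 1 / 4`. -/
theorem nehariSC.weight_le (ha : 0 ≤ a) (hb : 0 ≤ b) (hp : 4 ≤ p) (hlam : 0 ≤ lam)
    (hh : ∀ x, 0 ≤ h x) (hu : u ∈ nehariSC a b p h lam) :
    (1 / 4) * ∑' x, (lam * h x + 1) * u x ^ 2 ≤ J a b p h lam u := by
  have e₁ := nehariSC.fibDeriv_uPlus hp hlam hh hu
  have e₂ := nehariSC.fibDeriv_uMinus hp hlam hh hu
  have hJ := J_comb_eq_fib (a := a) (b := b) hp hlam hh hu.1 zero_le_one zero_le_one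
  have hD := dirichlet_comb (s := 1) (t := 1) (HLam.summable_sq (HLam.uPlus_mem hlam hh hu.1))
    (HLam.summable_sq (HLam.uMinus_mem hlam hh hu.1))
  rw [show (fun x => 1 * uPlus u x + 1 * uMinus u x) = u from comb_one_one u] at hD
  have hW : ∑' x, (lam * h x + 1) * u x ^ 2 = ∑' x, (lam * h x + 1) * uPlus u x ^ 2
      + ∑' x, (lam * h x + 1) * uMinus u x ^ 2 := by
    rw [← (HLam.summable_weight (HLam.uPlus_mem hlam hh hu.1)).tsum_add (HLam.summable_weight (HLam.uMinus_mem hlam hh hu.1))]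
    refine tsum_congr fun x => ?_
    rw [← uPlus_add_uMinus u x]
    linear_combination (lam * h x + 1) * 2 * uPlus_mul_uMinus u x
  have hW0 : 0 ≤ ∑' x, (lam * h x + 1) * u x ^ 2 := tsum_nonneg fun x =>
    mul_nonneg (add_nonneg (mul_nonneg hlam (hh x)) zero_le_one) (sq_nonneg _)
  have hD0 := dirichlet_self_nonneg u
  have hp0 : 0 < p := by linarith
  have hp' : 1 / p ≤ 1 / 4 := by gcongr
  have hP₁ := powSum_nonneg p (uPlus u)
  have hP₂ := powSum_nonneg p (uMinus u)
  rw [comb_one_one] at hJ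
  have : J a b p h lam u = (1 / 2 - 1 / p) * (a * dirichlet u u + ∑' x, (lam * h x + 1) * u x ^ 2)
      + (1 / 4 - 1 / p) * (b * dirichlet u u ^ 2)
      + 2 / p ^ 2 * (powSum p (uPlus u) + powSum p (uMinus u)) := by
    rw [hJ, hD, hW]
    simp only [fib, fibDeriv, quadForm, Real.one_rpow, one_pow, Real.log_one] at e₁ e₂ ⊢
    linear_combination (1 / p) * e₁ + (1 / p) * e₂
  rw [this]
  have k1 : 0 ≤ (1 / 4 - 1 / p) * (b * dirichlet u u ^ 2) :=
    mul_nonneg (by linarith) (by positivity)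
  have k2 : 0 ≤ 2 / p ^ 2 * (powSum p (uPlus u) + powSum p (uMinus u)) := by positivity
  have k3 : 1 / 4 * ∑' x, (lam * h x + 1) * u x ^ 2 ≤ (1 / 2 - 1 / p) *
      (a * dirichlet u u + ∑' x, (lam * h x + 1) * u x ^ 2) :=
    mul_le_mul (by linarith) (by linarith [mul_nonneg ha hD0]) hW0 (by linarith)
  linarith

theorem exists_one_lt_of_logSum_pos (hpos : 0 < logSum p u) : ∃ x, 1 < |u x| := by
  by_contra! hle
  refine absurd hpos (not_lt.2 (tsum_nonpos fun x => ?_))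
  refine mul_nonpos_of_nonneg_of_nonpos (Real.rpow_nonneg (abs_nonneg _) _)
    (Real.log_nonpos (sq_nonneg _) ((sq_le_one_iff_abs_le_one _).2 (hle x)))

/-- The constraint equates `logSum p (uPlus u)` with a positive quantity, while `|t| ^ p * log (t ^
2)` is positive only for `|t| > 1`. -/
theorem nehariSC.exists_one_lt (ha : 0 ≤ a) (hb : 0 ≤ b) (hp : 4 ≤ p) (hlam : 0 ≤ lam)
    (hh : ∀ x, 0 ≤ h x) (hu : u ∈ nehariSC a b p h lam) : ∃ x, 1 < u x := by
  have e := nehariSC.fibDeriv_uPlus hp hlam hh hu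
  simp only [fibDeriv, Real.one_rpow, one_pow, Real.log_one, zero_mul, add_zero, one_mul,
    mul_one] at e
  have h1 := quadForm_pos ha hlam hh (HLam.uPlus_mem hlam hh hu.1) hu.2.1
  have h2 := dirichlet_uPlus_uMinus_nonneg u
  have h3 := dirichlet_self_nonneg (uPlus u)
  have h4 := dirichlet_self_nonneg (uMinus u)
  obtain ⟨x, hx⟩ := exists_one_lt_of_logSum_pos (u := uPlus u) (p := p) (by
    have : 0 ≤ a * dirichlet (uPlus u) (uMinus u) := by positivity
    have : 0 ≤ b * (dirichlet (uPlus u) (uPlus u) + dirichlet (uMinus u) (uMinus u)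
      + 2 * dirichlet (uPlus u) (uMinus u)) * (dirichlet (uPlus u) (uPlus u)
      + dirichlet (uPlus u) (uMinus u)) := by positivity
    linarith)
  refine ⟨x, ?_⟩
  rw [LogKirchhoff.uPlus, abs_of_nonneg (le_max_right _ _)] at hx
  exact (lt_max_iff.1 hx).resolve_right (by norm_num)

theorem nehariSC.exists_lt_neg_one (ha : 0 ≤ a) (hb : 0 ≤ b) (hp : 4 ≤ p) (hlam : 0 ≤ lam)
    (hh : ∀ x, 0 ≤ h x) (hu : u ∈ nehariSC a b p h lam) : ∃ x, u x < -1 := by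
  have e := nehariSC.fibDeriv_uMinus hp hlam hh hu
  simp only [fibDeriv, Real.one_rpow, one_pow, Real.log_one, zero_mul, add_zero, one_mul,
    mul_one] at e
  have h1 := quadForm_pos ha hlam hh (HLam.uMinus_mem hlam hh hu.1) hu.2.2.1
  have h2 := dirichlet_uPlus_uMinus_nonneg u
  have h3 := dirichlet_self_nonneg (uPlus u)
  have h4 := dirichlet_self_nonneg (uMinus u)
  obtain ⟨x, hx⟩ := exists_one_lt_of_logSum_pos (u := uMinus u) (p := p) (by
    have : 0 ≤ a * dirichlet (uPlus u) (uMinus u) := by positivity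
    have : 0 ≤ b * (dirichlet (uMinus u) (uMinus u) + dirichlet (uPlus u) (uPlus u)
      + 2 * dirichlet (uPlus u) (uMinus u)) * (dirichlet (uMinus u) (uMinus u)
      + dirichlet (uPlus u) (uMinus u)) := by positivity
    linarith)
  refine ⟨x, ?_⟩
  rw [LogKirchhoff.uMinus, abs_of_nonpos (min_le_right _ _), lt_neg] at hx
  exact (min_lt_iff.1 hx).resolve_right (by norm_num)

end nehari

/-! ### The Dirichlet problem as a restriction of the problem on the lattice -/

variable {a b p lam : ℝ} {h : V → ℝ}

theorem H10.summable_sq {Ω : Set V} {u : V → ℝ} (hu : u ∈ H10 Ω) : Summable fun x => u x ^ 2 :=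
  mem_H1.1 hu.1

theorem H10.of_abs_le {Ω : Set V} {u v : V → ℝ} (hu : u ∈ H10 Ω) (C : ℝ)
    (hle : ∀ x, |v x| ≤ C * |u x|) : v ∈ H10 Ω := by
  refine ⟨mem_H1.2 ?_, fun x hx => abs_nonpos_iff.1 ((hle x).trans (by simp [hu.2 x hx]))⟩
  refine Summable.of_nonneg_of_le (fun x => sq_nonneg _) (fun x => ?_)
    ((H10.summable_sq hu).mul_left (C ^ 2))
  rw [← sq_abs, ← sq_abs (u x), ← mul_pow]
  exact pow_le_pow_left₀ (abs_nonneg _) (hle x) 2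

theorem H10.weight_mul_eq {u : V → ℝ} (hu : u ∈ H10 (well h)) (x : V) : h x * u x = 0 := by
  by_cases hx : x ∈ well h
  · rw [show h x = 0 from hx, zero_mul]
  · rw [hu.2 x hx, mul_zero]

theorem H10.mem_HLam {u : V → ℝ} (hu : u ∈ H10 (well h)) (lam : ℝ) : u ∈ HLam h lam := by
  refine ⟨hu.1, summable_zero.congr fun x => ?_⟩
  linear_combination -(lam * u x) * H10.weight_mul_eq hu x

theorem gradForm_eq_zero_of_notMem {Ω : Set V} (u : V → ℝ) {φ : V → ℝ} (hφ : ∀ x ∉ Ω, φ x = 0)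
    {x : V} (hx : x ∉ Ω ∪ vertexBoundary Ω) : gradForm u φ x = 0 := by
  rw [Set.mem_union, not_or] at hx
  rw [gradForm, Finset.sum_eq_zero, mul_zero]
  intro y hy
  have hyΩ : y ∉ Ω := fun hyΩ => hx.2 ⟨hx.1, y, hyΩ, (mem_nbr.1 hy).symm⟩
  rw [hφ x hx.1, hφ y hyΩ, sub_zero, mul_zero]

theorem tsum_subtype_eq_of_forall {S : Set V} {f : V → ℝ} (hf : ∀ x ∉ S, f x = 0) :
    ∑' x : S, f x = ∑' x, f x :=
  tsum_subtype_eq_of_support_subset fun x hx => by_contra fun hxS => hx (hf x hxS)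

theorem JΩ_eq (hp : 4 ≤ p) {u : V → ℝ} (hu : u ∈ H10 (well h)) (lam : ℝ) :
    JΩ a b p (well h) u = J a b p h lam u := by
  rw [J_eq (H10.mem_HLam hu lam)]
  unfold JΩ quadForm dirichlet powSum logSum
  rw [tsum_subtype_eq_of_forall (f := fun x => a * gradForm u u x) fun x hx => by
      simp [gradForm_eq_zero_of_notMem u hu.2 hx],
    tsum_subtype_eq_of_forall (f := gradForm u u) fun x hx => gradForm_eq_zero_of_notMem u hu.2 hx,
    tsum_subtype_eq_of_forall (f := fun x => u x ^ 2) fun x hx => by simp [hu.2 x hx],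
    tsum_subtype_eq_of_forall (f := fun x => |u x| ^ p) fun x hx => by
      simp [hu.2 x hx, (by linarith : p ≠ 0)],
    tsum_subtype_eq_of_forall (f := fun x => |u x| ^ p * Real.log (u x ^ 2)) fun x hx => by
      simp [hu.2 x hx],
    tsum_mul_left]
  have : ∑' x, (lam * h x + 1) * u x ^ 2 = ∑' x, u x ^ 2 := tsum_congr fun x => by
    linear_combination (lam * u x) * H10.weight_mul_eq hu x
  rw [this]
  ring

theorem dJ_eq_of_mem_H10 (u : V → ℝ) {φ : V → ℝ} (hφ : φ ∈ H10 (well h)) (lam : ℝ) :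
    dJ a b p h lam u φ = ∑' x, (a * gradForm u φ x + u x * φ x)
      + b * dirichlet u u * dirichlet u φ
      - ∑' x, |u x| ^ (p - 2) * u x * φ x * Real.log (u x ^ 2) := by
  have : ∀ x, a * gradForm u φ x + (lam * h x + 1) * u x * φ x = a * gradForm u φ x + u x * φ x :=
    fun x => by linear_combination (lam * u x) * H10.weight_mul_eq hφ x
  unfold dJ dirichlet
  simp only [this]

theorem dJΩ_eq {u φ : V → ℝ} (hu : u ∈ H10 (well h)) (hφ : φ ∈ H10 (well h)) (lam : ℝ) :
    dJΩ a b p (well h) u φ = dJ a b p h lam u φ := by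
  have hu2 := H10.summable_sq hu
  have hφ2 := H10.summable_sq hφ
  have huφ : Summable fun x => u x * φ x :=
    Summable.of_norm_bounded (hu2.add hφ2) fun x => by
      rw [Real.norm_eq_abs, abs_le]
      constructor <;> nlinarith [sq_nonneg (u x + φ x), sq_nonneg (u x - φ x)]
  rw [dJ_eq_of_mem_H10 u hφ,
    ((summable_gradForm hu2 hφ2).mul_left a).tsum_add huφ]
  unfold dJΩ dirichlet
  rw [tsum_subtype_eq_of_forall (f := fun x => a * gradForm u φ x) fun x hx => by
      simp [gradForm_eq_zero_of_notMem u hφ.2 hx],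
    tsum_subtype_eq_of_forall (f := gradForm u φ) fun x hx => gradForm_eq_zero_of_notMem u hφ.2 hx,
    tsum_subtype_eq_of_forall (f := gradForm u u) fun x hx => gradForm_eq_zero_of_notMem u hu.2 hx,
    tsum_subtype_eq_of_forall (f := fun x => u x * φ x) fun x hx => by simp [hφ.2 x hx],
    tsum_subtype_eq_of_forall (f := fun x => |u x| ^ (p - 2) * u x * φ x * Real.log (u x ^ 2))
      fun x hx => by simp [hφ.2 x hx]]

theorem mem_nehariSCΩ_iff {u : V → ℝ} (hu : u ∈ H10 (well h)) (lam : ℝ) :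
    u ∈ nehariSCΩ a b p (well h) ↔ u ∈ nehariSC a b p h lam := by
  have h₁ : uPlus u ∈ H10 (well h) := H10.of_abs_le hu 1 fun x => by simpa using abs_uPlus_le u x
  have h₂ : uMinus u ∈ H10 (well h) := H10.of_abs_le hu 1 fun x => by simpa using abs_uMinus_le u x
  simp only [nehariSCΩ, nehariSC, Set.mem_ofPred_eq, dJΩ_eq hu h₁ lam, dJΩ_eq hu h₂ lam, hu,
    H10.mem_HLam hu lam]

theorem exists_comb_mem_nehariSCΩ (ha : 0 ≤ a) (hb : 0 ≤ b) (hp : 4 ≤ p) (hh : ∀ x, 0 ≤ h x)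
    {u : V → ℝ} (hu : u ∈ H10 (well h)) (h₁ : uPlus u ≠ 0) (h₂ : uMinus u ≠ 0) :
    ∃ s t, 0 < s ∧ 0 < t ∧ comb s t u ∈ nehariSCΩ a b p (well h) := by
  obtain ⟨s, t, hs, ht, hmem⟩ :=
    exists_comb_mem_nehariSC ha hb hp le_rfl hh (H10.mem_HLam hu 0) h₁ h₂
  exact ⟨s, t, hs, ht,
    (mem_nehariSCΩ_iff (H10.of_abs_le hu _ (abs_comb_le hs.le ht.le u)) 0).2 hmem⟩

/-- Project a function equal to `1` and `-1` at two points of the well. Nonemptiness keeps both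
infima from being the default value `sInf ∅ = 0`. -/
theorem nehariSCΩ_nonempty (ha : 0 ≤ a) (hb : 0 ≤ b) (hp : 4 ≤ p) (hh : ∀ x, 0 ≤ h x)
    (hnt : (well h).Nontrivial) : (nehariSCΩ a b p (well h)).Nonempty := by
  obtain ⟨x, hx, y, hy, hxy⟩ := hnt
  set u : V → ℝ := fun z => if z = x then 1 else if z = y then -1 else 0 with hu
  have hmem : u ∈ H10 (well h) := by
    refine ⟨mem_H1.2 (summable_of_ne_finset_zero (s := {x, y}) fun z hz => ?_), fun z hz => ?_⟩
    · simp only [Finset.mem_insert, Finset.mem_singleton, not_or] at hz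
      simp [hu, hz.1, hz.2]
    · have h1 : z ≠ x := fun e => hz (e ▸ hx)
      have h2 : z ≠ y := fun e => hz (e ▸ hy)
      simp [hu, h1, h2]
  obtain ⟨s, t, -, -, hst⟩ := exists_comb_mem_nehariSCΩ ha hb hp hh hmem
    (uPlus_ne_zero.2 ⟨x, by simp [hu]⟩) (uMinus_ne_zero.2 ⟨y, by simp [hu, hxy.symm]⟩)
  exact ⟨_, hst⟩

theorem J_nonneg_of_mem_nehariSC (ha : 0 ≤ a) (hb : 0 ≤ b) (hp : 4 ≤ p) (hlam : 0 ≤ lam)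
    (hh : ∀ x, 0 ≤ h x) {u : V → ℝ} (hu : u ∈ nehariSC a b p h lam) : 0 ≤ J a b p h lam u :=
  (mul_nonneg (by norm_num) (tsum_nonneg fun x => mul_nonneg
    (add_nonneg (mul_nonneg hlam (hh x)) zero_le_one) (sq_nonneg _))).trans
    (nehariSC.weight_le ha hb hp hlam hh hu)

theorem mLam_le (ha : 0 ≤ a) (hb : 0 ≤ b) (hp : 4 ≤ p) (hlam : 0 ≤ lam) (hh : ∀ x, 0 ≤ h x)
    {u : V → ℝ} (hu : u ∈ nehariSC a b p h lam) : mLam a b p h lam ≤ J a b p h lam u :=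
  csInf_le ⟨0, by rintro _ ⟨v, hv, rfl⟩; exact J_nonneg_of_mem_nehariSC ha hb hp hlam hh hv⟩
    ⟨u, hu, rfl⟩

theorem mΩ_le (ha : 0 ≤ a) (hb : 0 ≤ b) (hp : 4 ≤ p) (hh : ∀ x, 0 ≤ h x)
    {u : V → ℝ} (hu : u ∈ nehariSCΩ a b p (well h)) : mΩ a b p (well h) ≤ J a b p h 0 u := by
  rw [← JΩ_eq hp hu.1]
  refine csInf_le ⟨0, ?_⟩ ⟨u, hu, rfl⟩
  rintro _ ⟨v, hv, rfl⟩
  rw [JΩ_eq hp hv.1 0]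
  exact J_nonneg_of_mem_nehariSC ha hb hp le_rfl hh ((mem_nehariSCΩ_iff hv.1 0).1 hv)

theorem mLam_le_mΩ (ha : 0 ≤ a) (hb : 0 ≤ b) (hp : 4 ≤ p) (hlam : 0 ≤ lam) (hh : ∀ x, 0 ≤ h x)
    (hnt : (well h).Nontrivial) : mLam a b p h lam ≤ mΩ a b p (well h) := by
  refine le_csInf ((nehariSCΩ_nonempty ha hb hp hh hnt).image _) ?_
  rintro _ ⟨u, hu, rfl⟩
  rw [JΩ_eq hp hu.1 lam]
  exact mLam_le ha hb hp hlam hh ((mem_nehariSCΩ_iff hu.1 lam).1 hu)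

/-! ### Passage to the limit of a deep potential well -/

theorem HLam.mem_zero {u : V → ℝ} (hu : u ∈ HLam h lam) : u ∈ HLam h 0 :=
  ⟨hu.1, by simp⟩

theorem J_zero_le (hlam : 0 ≤ lam) (hh : ∀ x, 0 ≤ h x) {u : V → ℝ} (hu : u ∈ HLam h lam) :
    J a b p h 0 u ≤ J a b p h lam u := by
  have h0 := HLam.mem_zero hu
  rw [J_eq hu, J_eq h0]
  have : quadForm a h 0 u ≤ quadForm a h lam u := by
    refine add_le_add_right ((HLam.summable_weight h0).tsum_le_tsum (fun x => ?_)
      (HLam.summable_weight hu)) _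
    have := mul_nonneg hlam (hh x)
    exact mul_le_mul_of_nonneg_right (by linarith) (sq_nonneg _)
  linarith

/-- Taken at `λ = 0` because `λ_k ∫ h u_k²` is only known to be bounded here; discarding it lowers
the energy, which is the useful direction. -/
theorem TailConv.tendsto_J_zero (hp : 4 ≤ p) {T : Finset V} {u : ℕ → V → ℝ} {u₀ : V → ℝ}
    (H : TailConv T u u₀) :
    Tendsto (fun k => J a b p h 0 (u k)) atTop (𝓝 (J a b p h 0 u₀)) := by
  have hmem : ∀ {v : V → ℝ}, (Summable fun x => v x ^ 2) → v ∈ HLam h 0 := fun hv =>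
    ⟨mem_H1.2 hv, by simp⟩
  rw [J_eq (hmem H.limit_summable_sq)]
  simp_rw [fun k => J_eq (a := a) (b := b) (p := p) (hmem (H.summable_sq k))]
  have hG : Tendsto (fun k => dirichlet (u k) (u k)) atTop (𝓝 (dirichlet u₀ u₀)) :=
    H.tendsto_gradForm
  have hQ : Tendsto (fun k => quadForm a h 0 (u k)) atTop (𝓝 (quadForm a h 0 u₀)) := by
    simp only [quadForm, zero_mul, zero_add, one_mul]
    exact (hG.const_mul a).add H.tendsto_sq
  exact (((hQ.const_mul _).add ((hG.pow 2).const_mul _)).add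
    ((H.tendsto_rpow (by linarith)).const_mul _)).sub
    ((H.tendsto_rpow_mul_log (by linarith)).const_mul _)

theorem TailConv.tendsto_normH1 {T : Finset V} {u : ℕ → V → ℝ} {u₀ : V → ℝ}
    (H : TailConv T u u₀) : Tendsto (fun k => normH1 (u k - u₀)) atTop (𝓝 0) := by
  have H' := H.sub_limit
  have h1 := (H'.tendsto_gradForm.add H'.tendsto_sq).sqrt
  have e : ∀ k, normH1 (u k - u₀) = Real.sqrt (∑' x, gradForm (u k - u₀) (u k - u₀) x
      + ∑' x, (u k - u₀) x ^ 2) := fun k => by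
    rw [normH1, (summable_gradForm (H'.summable_sq k) (H'.summable_sq k)).tsum_add
      (H'.summable_sq k)]
  simp_rw [e]
  simpa [gradForm] using h1

/-- The potential term vanishes since `h φ = 0`, and the other sums involving `φ` are finite. Only
the Kirchhoff coefficient needs convergence of the full Dirichlet energy. -/
theorem TailConv.tendsto_dJ (hp : 2 < p) {T : Finset V} {u : ℕ → V → ℝ} {u₀ φ : V → ℝ}
    (H : TailConv T u u₀) (hT : well h ⊆ T) (hφ : φ ∈ H10 (well h)) (lam : ℕ → ℝ) (lam₀ : ℝ) :
    Tendsto (fun k => dJ a b p h (lam k) (u k) φ) atTop (𝓝 (dJ a b p h lam₀ u₀ φ)) := by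
  have hφT : ∀ x ∉ T, φ x = 0 := fun x hx => hφ.2 x fun hx' => hx (hT hx')
  have hgr : ∀ (v : V → ℝ), ∀ x ∉ T ∪ T.biUnion nbr, gradForm v φ x = 0 := by
    intro v x hx
    refine gradForm_eq_zero_of_notMem (Ω := T) v hφT fun hx' => hx ?_
    rcases hx' with hx' | ⟨-, y, hy, hyx⟩
    · exact Finset.mem_union_left _ hx'
    · exact Finset.mem_union_right _ (Finset.mem_biUnion.2 ⟨y, hy, mem_nbr.2 hyx⟩)
  have hφS : ∀ x ∉ T ∪ T.biUnion nbr, φ x = 0 := fun x hx =>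
    hφT x fun hx' => hx (Finset.mem_union_left _ hx')
  have hsum : ∀ {f : ℕ → V → ℝ} {f₀ : V → ℝ}, (∀ x, Tendsto (fun k => f k x) atTop (𝓝 (f₀ x))) →
      (∀ k, ∀ x ∉ T ∪ T.biUnion nbr, f k x = 0) → (∀ x ∉ T ∪ T.biUnion nbr, f₀ x = 0) →
      Tendsto (fun k => ∑' x, f k x) atTop (𝓝 (∑' x, f₀ x)) := by
    intro f f₀ hf h1 h2
    rw [tsum_eq_sum h2]
    refine Tendsto.congr (fun k => (tsum_eq_sum (h1 k)).symm) ?_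
    exact tendsto_finsetSum _ fun x _ => hf x
  have hgt : ∀ x, Tendsto (fun k => gradForm (u k) φ x) atTop (𝓝 (gradForm u₀ φ x)) := fun x =>
    (tendsto_finsetSum _ fun y _ =>
      ((H.tendsto_apply y).sub (H.tendsto_apply x)).mul_const _).const_mul _
  rw [dJ_eq_of_mem_H10 u₀ hφ]
  refine Tendsto.congr (fun k => (dJ_eq_of_mem_H10 (u k) hφ (lam k)).symm) ?_
  refine ((hsum (fun x => ?_) (fun k x hx => ?_) (fun x hx => ?_)).add
    ((H.tendsto_gradForm.const_mul b).mul (hsum hgt (fun k x hx => hgr _ x hx)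
      (fun x hx => hgr _ x hx)))).sub (hsum (fun x => ?_) (fun k x hx => ?_) (fun x hx => ?_))
  · exact ((hgt x).const_mul a).add ((H.tendsto_apply x).mul_const _)
  · rw [hgr _ x hx, hφS x hx]; ring
  · rw [hgr _ x hx, hφS x hx]; ring
  · have h1 := ((continuous_rpow_mul_log (p := p - 2) (by linarith)).tendsto (u₀ x)).comp
      (H.tendsto_apply x)
    have h2 := h1.mul ((H.tendsto_apply x).mul_const (φ x))
    refine (h2.congr fun k => ?_).trans_eq ?_
    · simp only [Function.comp]; ring
    · congr 1; ring
  · rw [hφS x hx]; ring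
  · rw [hφS x hx]; ring

theorem TailConv.comb {T : Finset V} {u : ℕ → V → ℝ} {u₀ : V → ℝ} (H : TailConv T u u₀)
    {s t : ℝ} (hs : 0 ≤ s) (ht : 0 ≤ t) :
    TailConv T (fun k => LogKirchhoff.comb s t (u k)) (LogKirchhoff.comb s t u₀) :=
  H.of_abs_le (s + t) (fun k x => abs_comb_le hs ht (u k) x) fun x =>
    (((H.tendsto_apply x).max tendsto_const_nhds).const_mul s).add
      (((H.tendsto_apply x).min tendsto_const_nhds).const_mul t)

theorem exists_subseq_tailConv {M : ℝ} (hM : 0 < M) (hfin : {x | h x < M}.Finite)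
    (hh : ∀ x, 0 ≤ h x) {lam : ℕ → ℝ} (hlam : ∀ k, 0 < lam k) (hlim : Tendsto lam atTop atTop)
    {u : ℕ → V → ℝ} (hu : ∀ k, u k ∈ HLam h (lam k)) {C : ℝ}
    (hC : ∀ k, ∑' x, (lam k * h x + 1) * u k x ^ 2 ≤ C) :
    ∃ (κ : ℕ → ℕ) (u₀ : V → ℝ), StrictMono κ ∧ TailConv hfin.toFinset (fun k => u (κ k)) u₀ ∧
      u₀ ∈ H10 (well h) := by
  have hw0 : ∀ k x, 0 ≤ (lam k * h x + 1) * u k x ^ 2 := fun k x =>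
    mul_nonneg (add_nonneg (mul_nonneg (hlam k).le (hh x)) zero_le_one) (sq_nonneg _)
  have hpt : ∀ k x, (lam k * h x + 1) * u k x ^ 2 ≤ C := fun k x =>
    ((HLam.summable_weight (hu k)).le_tsum x fun y _ => hw0 k y).trans (hC k)
  have hbd : ∀ k, u k ∈ Set.univ.pi fun _ : V => Set.Icc (-Real.sqrt C) (Real.sqrt C) := by
    intro k x _
    refine abs_le.1 (Real.abs_le_sqrt ((le_mul_of_one_le_left (sq_nonneg _) ?_).trans (hpt k x)))
    linarith [mul_nonneg (hlam k).le (hh x)]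
  -- Tychonoff on the countable product of intervals gives a pointwise convergent subsequence.
  obtain ⟨u₀, -, κ, hκ, hconv⟩ :=
    (isCompact_univ_pi fun _ : V => isCompact_Icc).tendsto_subseq hbd
  have hptw : ∀ x, Tendsto (fun k => u (κ k) x) atTop (𝓝 (u₀ x)) := fun x =>
    (tendsto_pi_nhds.1 hconv) x
  have hlim' : Tendsto (fun k => C / lam (κ k)) atTop (𝓝 0) :=
    (hlim.comp hκ.tendsto_atTop).const_div_atTop C
  have hzero : ∀ x ∉ well h, u₀ x = 0 := by
    intro x hx
    have hxpos : 0 < h x := (hh x).lt_of_ne fun e => hx e.symm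
    have h1 : h x * u₀ x ^ 2 ≤ 0 := by
      refine le_of_tendsto_of_tendsto' (((hptw x).pow 2).const_mul (h x)) hlim' fun k => ?_
      rw [le_div_iff₀ (hlam _)]
      nlinarith [hpt (κ k) x, sq_nonneg (u (κ k) x)]
    have h2 : u₀ x ^ 2 ≤ 0 := by
      by_contra! h3
      exact absurd h1 (not_le.2 (mul_pos hxpos h3))
    exact pow_eq_zero_iff two_ne_zero |>.1 (le_antisymm h2 (sq_nonneg _))
  have hT : ∀ x ∉ hfin.toFinset, M ≤ h x := fun x hx => by simpa using hx
  have H : TailConv hfin.toFinset (fun k => u (κ k)) u₀ := by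
    refine ⟨fun k => HLam.summable_sq (hu _), hptw, fun x hx => hzero x fun e => ?_, ?_⟩
    · exact absurd (hT x hx) (not_le.2 (by rw [show h x = 0 from e]; exact hM))
    · refine squeeze_zero (fun k => tsum_nonneg (tailSq_nonneg _ _)) (fun k => ?_)
        (by simpa using hlim'.div_const M)
      -- Off `{h < M}` the weight is at least `λ M`, so the tail is at most `C / (λ M)`.
      rw [div_div, le_div_iff₀ (mul_pos (hlam _) hM), ← tsum_mul_right]
      refine (Summable.tsum_le_tsum (fun x => ?_)
        ((summable_tailSq _ (HLam.summable_sq (hu _))).mul_right _)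
        (HLam.summable_weight (hu _))).trans (hC (κ k))
      unfold tailSq
      split_ifs with hx
      · rw [zero_mul]; exact hw0 _ _
      · have := mul_le_mul_of_nonneg_left (hT x hx) (hlam (κ k)).le
        nlinarith [sq_nonneg (u (κ k) x)]
  exact ⟨κ, u₀, hκ, H, mem_H1.2 H.limit_summable_sq, hzero⟩

theorem exists_subseq_of_nehariSC (ha : 0 ≤ a) (hb : 0 ≤ b) (hp : 4 ≤ p) {M : ℝ} (hM : 0 < M)
    (hfin : {x | h x < M}.Finite) (hh : ∀ x, 0 ≤ h x) {lam : ℕ → ℝ} (hlam : ∀ k, 0 < lam k)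
    (hlim : Tendsto lam atTop atTop) {u : ℕ → V → ℝ} (hu : ∀ k, u k ∈ nehariSC a b p h (lam k))
    {C : ℝ} (hC : ∀ k, J a b p h (lam k) (u k) ≤ C) :
    ∃ (κ : ℕ → ℕ) (u₀ : V → ℝ), StrictMono κ ∧ TailConv hfin.toFinset (fun k => u (κ k)) u₀ ∧
      u₀ ∈ H10 (well h) ∧ uPlus u₀ ≠ 0 ∧ uMinus u₀ ≠ 0 := by
  obtain ⟨κ, u₀, hκ, H, hu₀⟩ := exists_subseq_tailConv (C := 4 * C) hM hfin hh hlam hlim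
    (fun k => (hu k).1) fun k => by
      linarith [hC k, nehariSC.weight_le ha hb hp (hlam k).le hh (hu k)]
  refine ⟨κ, u₀, hκ, H, hu₀, uPlus_ne_zero.2 (H.exists_limit_pos fun k =>
    nehariSC.exists_one_lt ha hb hp (hlam _).le hh (hu _)), uMinus_ne_zero.2 ?_⟩
  obtain ⟨x, hx⟩ := H.neg.exists_limit_pos fun k => by
    obtain ⟨x, hx⟩ := nehariSC.exists_lt_neg_one ha hb hp (hlam _).le hh (hu (κ k))
    exact ⟨x, by linarith⟩
  exact ⟨x, by linarith⟩

/-! ### Convergence of the levels and of the minimisers -/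

/-- The limit need not satisfy the constraints. Its projection does, and applying the same `s, t` to
`u k` does not raise the energy, as `u k` is maximal on its own fiber. -/
theorem mΩ_le_of_forall_le (ha : 0 ≤ a) (hb : 0 ≤ b) (hp : 4 ≤ p) {M : ℝ} (hM : 0 < M)
    (hfin : {x | h x < M}.Finite) (hh : ∀ x, 0 ≤ h x) {lam : ℕ → ℝ} (hlam : ∀ k, 0 < lam k)
    (hlim : Tendsto lam atTop atTop) {u : ℕ → V → ℝ} (hu : ∀ k, u k ∈ nehariSC a b p h (lam k))
    {C : ℝ} (hC : ∀ k, J a b p h (lam k) (u k) ≤ C) : mΩ a b p (well h) ≤ C := by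
  obtain ⟨κ, u₀, -, H, hu₀, h₁, h₂⟩ :=
    exists_subseq_of_nehariSC ha hb hp hM hfin hh hlam hlim hu hC
  obtain ⟨s, t, hs, ht, hst⟩ := exists_comb_mem_nehariSCΩ ha hb hp hh hu₀ h₁ h₂
  refine (mΩ_le ha hb hp hh hst).trans
    (le_of_tendsto' ((H.comb hs.le ht.le).tendsto_J_zero hp) fun k => ?_)
  exact ((J_zero_le (hlam _).le hh (HLam.comb_mem (hlam _).le hh (hu _).1 hs.le ht.le)).trans
    (nehariSC.J_comb_le ha hb hp (hlam _).le hh (hu _) hs.le ht.le)).trans (hC _)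

theorem tendsto_mLam (ha : 0 ≤ a) (hb : 0 ≤ b) (hp : 4 ≤ p) {M : ℝ} (hM : 0 < M)
    (hfin : {x | h x < M}.Finite) (hh : ∀ x, 0 ≤ h x) (hnt : (well h).Nontrivial) :
    Tendsto (fun lam : ℝ => mLam a b p h lam) atTop (𝓝 (mΩ a b p (well h))) := by
  refine tendsto_order.2 ⟨fun c hc => ?_, fun c hc => ?_⟩
  · by_contra hcon
    have hfreq : ∀ n : ℕ, ∃ lam : ℝ, (n : ℝ) + 1 ≤ lam ∧ mLam a b p h lam ≤ c := by
      intro n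
      obtain ⟨lam, h1, h2⟩ := frequently_atTop.1 (not_eventually.1 hcon) (n + 1)
      exact ⟨lam, h1, not_lt.1 h2⟩
    choose lam hlam hle using hfreq
    have hpos : ∀ k, 0 < lam k := fun k => lt_of_lt_of_le (by positivity) (hlam k)
    have hlim : Tendsto lam atTop atTop :=
      tendsto_atTop_mono (fun k => by linarith [hlam k]) tendsto_natCast_atTop_atTop
    obtain ⟨c', hcc', hc'⟩ := exists_between hc
    have hex : ∀ k, ∃ u ∈ nehariSC a b p h (lam k), J a b p h (lam k) u < c' := by
      intro k
      obtain ⟨v, hv⟩ := nehariSCΩ_nonempty ha hb hp hh hnt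
      obtain ⟨_, ⟨u, hu, rfl⟩, hlt⟩ := exists_lt_of_csInf_lt
        (⟨_, v, (mem_nehariSCΩ_iff hv.1 (lam k)).1 hv, rfl⟩ :
          (J a b p h (lam k) '' nehariSC a b p h (lam k)).Nonempty) ((hle k).trans_lt hcc')
      exact ⟨u, hu, hlt⟩
    choose u hu hJ using hex
    exact absurd (mΩ_le_of_forall_le ha hb hp hM hfin hh hpos hlim hu fun k => (hJ k).le)
      (not_le.2 hc')
  · filter_upwards [eventually_ge_atTop 0] with lam hlam
    exact (mLam_le_mΩ ha hb hp hlam hh hnt).trans_lt hc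

theorem IsSignChangingSol.mem_nehariSC (hlam : 0 ≤ lam) (hh : ∀ x, 0 ≤ h x) {u : V → ℝ}
    (hu : IsSignChangingSol a b p h lam u) : u ∈ nehariSC a b p h lam :=
  ⟨hu.1, hu.2.2.1, hu.2.2.2, hu.2.1 _ (HLam.uPlus_mem hlam hh hu.1),
    hu.2.1 _ (HLam.uMinus_mem hlam hh hu.1)⟩

theorem exists_subseq_tendsto_leastEnergySol (ha : 0 ≤ a) (hb : 0 ≤ b) (hp : 4 ≤ p) {M : ℝ}
    (hM : 0 < M) (hfin : {x | h x < M}.Finite) (hh : ∀ x, 0 ≤ h x) (hnt : (well h).Nontrivial)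
    {lam : ℕ → ℝ} (hlam : ∀ k, 0 < lam k) (hlim : Tendsto lam atTop atTop) {u : ℕ → V → ℝ}
    (hu : ∀ k, IsLeastEnergySol a b p h (lam k) (u k)) :
    ∃ (κ : ℕ → ℕ) (u₀ : V → ℝ), StrictMono κ ∧ IsLeastEnergySolΩ a b p (well h) u₀ ∧
      Tendsto (fun k => normH1 (u (κ k) - u₀)) atTop (𝓝 0) := by
  have hN : ∀ k, u k ∈ nehariSC a b p h (lam k) := fun k =>
    IsSignChangingSol.mem_nehariSC (hlam k).le hh (hu k).1
  obtain ⟨κ, u₀, hκ, H, hu₀, h₁, h₂⟩ :=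
    exists_subseq_of_nehariSC ha hb hp hM hfin hh hlam hlim hN fun k =>
      (hu k).2.trans_le (mLam_le_mΩ ha hb hp (hlam k).le hh hnt)
  have hT : well h ⊆ hfin.toFinset := fun x hx => by
    have hx' : h x = 0 := hx
    simpa [hx'] using hM
  have hweak : ∀ φ ∈ H10 (well h), dJΩ a b p (well h) u₀ φ = 0 := fun φ hφ => by
    rw [dJΩ_eq hu₀ hφ 0]
    refine tendsto_nhds_unique (H.tendsto_dJ (by linarith) hT hφ (fun k => lam (κ k)) 0) ?_
    simp_rw [fun k => (hu (κ k)).1.2.1 φ (H10.mem_HLam hφ _)]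
    exact tendsto_const_nhds
  have hmem : u₀ ∈ nehariSCΩ a b p (well h) := ⟨hu₀, h₁, h₂,
    hweak _ (H10.of_abs_le hu₀ 1 fun x => by simpa using abs_uPlus_le u₀ x),
    hweak _ (H10.of_abs_le hu₀ 1 fun x => by simpa using abs_uMinus_le u₀ x)⟩
  refine ⟨κ, u₀, hκ, ⟨⟨hu₀, hweak, h₁, h₂⟩, ?_⟩, H.tendsto_normH1⟩
  -- The energy is squeezed: the limit of `J_0` along the sequence is at most `m_Ω`, and `u₀` lies
  -- in `ℳ_Ω`.
  rw [JΩ_eq hp hu₀ 0]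
  refine le_antisymm (le_of_tendsto' (H.tendsto_J_zero hp) fun k => ?_) (mΩ_le ha hb hp hh hmem)
  exact ((J_zero_le (hlam _).le hh (hN _).1).trans_eq (hu _).2).trans
    (mLam_le_mΩ ha hb hp (hlam _).le hh hnt)

end LogKirchhoff

theorem theorem1p3 (a b p : ℝ) (ha : 0 < a) (hb : 0 < b) (hp : 6 < p) (h : V → ℝ)
    (h_nonneg : ∀ x, 0 ≤ h x)
    (well_connected : (lattice.induce (well h)).Connected)
    (well_bounded : Bornology.IsBounded (well h))
    (well_nontrivial : (well h).Nontrivial)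
    (h_sublevel : ∃ M : ℝ, 0 < M ∧ {x | h x < M}.Finite) :
    Tendsto (fun lam : ℝ => mLam a b p h lam) atTop (𝓝 (mΩ a b p (well h))) ∧
    ∀ (lam : ℕ → ℝ) (u : ℕ → V → ℝ), Tendsto lam atTop atTop →
      (∀ᶠ k in atTop, IsLeastEnergySol a b p h (lam k) (u k)) →
      ∃ (κ : ℕ → ℕ) (u₀ : V → ℝ), StrictMono κ ∧
        IsLeastEnergySolΩ a b p (well h) u₀ ∧
        Tendsto (fun k => normH1 (u (κ k) - u₀)) atTop (𝓝 0) := by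
  obtain ⟨M, hM, hfin⟩ := h_sublevel
  have hp4 : 4 ≤ p := by linarith
  refine ⟨tendsto_mLam ha.le hb.le hp4 hM hfin h_nonneg well_nontrivial, fun lam u hlim hu => ?_⟩
  -- Shifting by `N` makes the eventual hypotheses and `λ > 0` hold for every index.
  obtain ⟨N, hN⟩ := eventually_atTop.1 (hu.and (hlim.eventually_gt_atTop 0))
  obtain ⟨κ, u₀, hκ, hu₀, hconv⟩ := exists_subseq_tendsto_leastEnergySol ha.le hb.le hp4 hM hfin
    h_nonneg well_nontrivial (lam := fun k => lam (k + N)) (u := fun k => u (k + N))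
    (fun k => (hN _ (Nat.le_add_left N k)).2) (hlim.comp (tendsto_add_atTop_nat N))
    (fun k => (hN _ (Nat.le_add_left N k)).1)
  exact ⟨fun k => κ k + N, u₀, hκ.add_const N, hu₀, hconv⟩
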